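/- **Conventions.** Let $T=(T,m,u)$ be a monad on a monoidal category $(\mathcal M,\otimes,K)$ in which every idempotent morphism splits. Coherence isomorphisms of monoidal categories are suppressed from the notation (the categories need not be strict), and an object also denotes its identity morphism. Let $\mathcal M^T$ be the Eilenberg–Moore category of $T$-algebras and $U:\mathcal M^T\to\mathcal M$ the forgetful functor. A *separable Frobenius structure* on a functor $F:(\mathcal N,\boxtimes,R)\to(\mathcal M,\otimes,K)$ consists of a (lax) monoidal structure $p_{X,Y}:FX\otimes FY\to F(X\boxtimes Y)$, $p_0:K\to FR$ and an opmonoidal structure $i_{X,Y}:F(X\boxtimes Y)\to FX\otimes FY$, $i_0:FR\to K$ such that, for all objects $X,Y,Z$ of $\mathcal N$, $$(p_{X,Y}\otimes FZ)\circ(FX\otimes i_{Y,Z})=i_{X\boxtimes Y,Z}\circ p_{X,Y\boxtimes Z},\qquad (FX\otimes p_{Y,Z})\circ(i_{X,Y}\otimes FZ)=i_{X,Y\boxtimes Z}\circ p_{X\boxtimes Y,Z},\qquad p_{X,Y}\circ i_{X,Y}=F(X\boxtimes Y).$$ A *weak bimonad structure* on $T$ is a monoidal structure $(\boxtimes,(R,r))$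 on $\mathcal M^T$ together with a separable Frobenius structure $(p,p_0,i,i_0)$ on $U$. For $T$-algebras $(A,a)$, $(B,b)$ write $(A,a)\boxtimes(B,b)=(A\Box B,\,a\Box b)$. An *isomorphism* between two weak bimonad structures on $T$ is a strong monoidal structure on the identity functor of $\mathcal M^T$, from the first monoidal structure to the second, that is compatible with the two monoidal structures and with the two opmonoidal structures on $U$. **Theorem 1.2.** To give $T$ the structure of a weak bimonad is equivalent to giving the endofunctor $T$ the structure of an opmonoidal functor $(T,\tau,\tau_0)$, with $\tau_{X,Y}:T(X\otimes Y)\to TX\otimes TY$ and $\tau_0:TK\to K$, such that for all objects $X,Y,Z$ of $\mathcal M$: 1. $m_X\circ T\big((TX\otimes\tau_0)\circ(TX\otimes m_K)\circ\tau_{X,TK}\big)\circ Tu_{X\otimes TK}=(TX\otimes\tau_0)\circ(TX\otimes m_K)\circ\tau_{X,TK}$; 2. $m_X\circ T\big((\tau_0\otimes TX)\circ(m_K\otimes TX)\circ\tau_{TK,X}\big)\circ Tu_{TK\otimes X}=(\tau_0\otimes TX)\circ(m_K\otimes TX)\circ\tau_{TK,X}$; 3. $(TX\otimes m_Y\otimes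 TZ)\circ(\tau_{X,TY}\otimes TZ)\circ(u_{X\otimes TY}\otimes TZ)\circ(X\otimes\tau_{Y,Z})\circ(X\otimes u_{Y\otimes Z})=(\tau_{X,Y}\otimes TZ)\circ\tau_{X\otimes Y,Z}\circ u_{X\otimes Y\otimes Z}$; 4. $(TX\otimes m_Y\otimes TZ)\circ(TX\otimes\tau_{TY,Z})\circ(TX\otimes u_{TY\otimes Z})\circ(\tau_{X,Y}\otimes Z)\circ(u_{X\otimes Y}\otimes Z)=(\tau_{X,Y}\otimes TZ)\circ\tau_{X\otimes Y,Z}\circ u_{X\otimes Y\otimes Z}$; 5. $(m_X\otimes m_Y)\circ\tau_{TX,TY}\circ T\tau_{X,Y}=\tau_{X,Y}\circ m_{X\otimes Y}$. Precisely: for every weak bimonad structure on $T$, the morphisms $$\tau_0=i_0\circ r\circ Tp_0,\qquad \tau_{X,Y}=i_{TX,TY}\circ(m_X\Box m_Y)\circ Tp_{TX,TY}\circ T(u_X\otimes u_Y)$$ form an opmonoidal structure on $T$ satisfying 1–5; every opmonoidal structure on $T$ satisfying 1–5 arises in this way; and two weak bimonad structures on $T$ give the same $(\tau,\tau_0)$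 if and only if they are isomorphic, the isomorphism between them then being unique. -/

import Mathlib

open CategoryTheory MonoidalCategory Functor.LaxMonoidal Functor.OplaxMonoidal

universe v v' u u'

/-- A separable Frobenius structure on a functor `F` between monoidal categories: a (lax) monoidal
structure `p = μ F`, `p₀ = ε F` and an opmonoidal structure `i = δ F`, `i₀ = η F` satisfying the two
Frobenius conditions and the separability condition `p ∘ i = 1`. -/
class SeparableFrobenius {N : Type u'} [Category.{v'} N] [MonoidalCategory N]
    {M : Type u} [Category.{v} M] [MonoidalCategory M] (F : N ⥤ M)
    extends F.LaxMonoidal, F.OplaxMonoidal where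
  frobenius_left : ∀ X Y Z : N,
    F.obj X ◁ δ Y Z ≫ (α_ (F.obj X) (F.obj Y) (F.obj Z)).inv ≫ μ X Y ▷ F.obj Z =
      μ X (Y ⊗ Z) ≫ F.map (α_ X Y Z).inv ≫ δ (X ⊗ Y) Z
  frobenius_right : ∀ X Y Z : N,
    δ X Y ▷ F.obj Z ≫ (α_ (F.obj X) (F.obj Y) (F.obj Z)).hom ≫ F.obj X ◁ μ Y Z =
      μ (X ⊗ Y) Z ≫ F.map (α_ X Y Z).hom ≫ δ X (Y ⊗ Z)
  separable : ∀ X Y : N, δ X Y ≫ μ X Y = 𝟙 (F.obj (X ⊗ Y))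

/-- A weak bimonad structure on the monad `T`: a monoidal structure on the Eilenberg-Moore
category of `T`, and a separable Frobenius structure on the forgetful functor. -/
structure WeakBimonadStructure {M : Type u} [Category.{v} M] [MonoidalCategory M]
    (T : Monad M) where
  monoidal : MonoidalCategory T.Algebra
  frobenius : SeparableFrobenius T.forget

namespace WeakBimonadStructure

variable {M : Type u} [Category.{v} M] [MonoidalCategory M] {T : Monad M}

/-- The Eilenberg-Moore category of `T`, regarded as a monoidal category by means of `W`. -/
def Alg (_W : WeakBimonadStructure T) : Type (max u v) := T.Algebra

instance (W : WeakBimonadStructure T) : Category.{v} W.Alg :=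
  inferInstanceAs (Category.{v} T.Algebra)

instance (W : WeakBimonadStructure T) : MonoidalCategory W.Alg := W.monoidal

/-- The forgetful functor. -/
def forget (W : WeakBimonadStructure T) : W.Alg ⥤ M := T.forget

instance (W : WeakBimonadStructure T) : SeparableFrobenius W.forget := W.frobenius

/-- The action `a : T A ⟶ A` of a `T`-algebra `(A, a)`. -/
def act (W : WeakBimonadStructure T) (A : W.Alg) :
    T.obj (W.forget.obj A) ⟶ W.forget.obj A :=
  Monad.Algebra.a (T := T) A

/-- The free `T`-algebra `(T X, m_X)`. -/
def freeAlg (W : WeakBimonadStructure T) (X : M) : W.Alg := T.free.obj X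

/-- The morphism `τ₀ : T K ⟶ T R ⟶ R ⟶ K`, where `(R, r)` is the monoidal unit of the
category of `T`-algebras. -/
def tauZero (W : WeakBimonadStructure T) : T.obj (𝟙_ M) ⟶ 𝟙_ M :=
  T.map (ε W.forget) ≫ W.act (𝟙_ W.Alg) ≫ η W.forget

/-- The morphism
`τ_{X,Y} : T (X ⊗ Y) ⟶ T (T X ⊗ T Y) ⟶ T (T X □ T Y) ⟶ T X □ T Y ⟶ T X ⊗ T Y`. -/
def tau (W : WeakBimonadStructure T) (X Y : M) : T.obj (X ⊗ Y) ⟶ T.obj X ⊗ T.obj Y :=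
  T.map (T.η.app X ⊗ₘ T.η.app Y) ≫
    T.map (μ W.forget (W.freeAlg X) (W.freeAlg Y)) ≫
      W.act (W.freeAlg X ⊗ W.freeAlg Y) ≫ δ W.forget (W.freeAlg X) (W.freeAlg Y)

/-- The identity functor of the category of `T`-algebras, between the monoidal categories
defined by two weak bimonad structures. -/
def idFunctor (W W' : WeakBimonadStructure T) : W.Alg ⥤ W'.Alg := 𝟭 T.Algebra

/-- An isomorphism between two weak bimonad structures on the same monad: a strong monoidal
structure on the identity functor of the category of `T`-algebras that is compatible with the
monoidal and the opmonoidal structures of the two forgetful functors. -/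
structure Iso (W W' : WeakBimonadStructure T) where
  monoidal : (idFunctor W W').Monoidal
  ε_comp : ε W'.forget ≫ W'.forget.map (ε (idFunctor W W')) = ε W.forget
  μ_comp : ∀ A B : W.Alg,
    μ W'.forget ((idFunctor W W').obj A) ((idFunctor W W').obj B) ≫
      W'.forget.map (μ (idFunctor W W') A B) = μ W.forget A B
  comp_η : W'.forget.map (η (idFunctor W W')) ≫ η W'.forget = η W.forget
  comp_δ : ∀ A B : W.Alg,
    W'.forget.map (δ (idFunctor W W') A B) ≫
      δ W'.forget ((idFunctor W W').obj A) ((idFunctor W W').obj B) = δ W.forget A B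

end WeakBimonadStructure

/-- An opmonoidal structure `τ = δ`, `τ₀ = η` on the endofunctor underlying the monad `T`,
satisfying the five compatibility conditions with the multiplication `m = T.μ` and the unit
`u = T.η` of the monad. -/
structure CompatibleOpmonoidalStructure {M : Type u} [Category.{v} M] [MonoidalCategory M]
    (T : Monad M) extends T.toFunctor.OplaxMonoidal where
  tau_1 : ∀ X : M,
    T.map (T.η.app (X ⊗ T.obj (𝟙_ M))) ≫ T.map (δ X (T.obj (𝟙_ M))) ≫
        T.map (T.obj X ◁ T.μ.app (𝟙_ M)) ≫ T.map (T.obj X ◁ η) ≫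
          T.map (ρ_ (T.obj X)).hom ≫ T.μ.app X =
      δ X (T.obj (𝟙_ M)) ≫ T.obj X ◁ T.μ.app (𝟙_ M) ≫ T.obj X ◁ η ≫ (ρ_ (T.obj X)).hom
  tau_2 : ∀ X : M,
    T.map (T.η.app (T.obj (𝟙_ M) ⊗ X)) ≫ T.map (δ (T.obj (𝟙_ M)) X) ≫
        T.map (T.μ.app (𝟙_ M) ▷ T.obj X) ≫ T.map (η ▷ T.obj X) ≫
          T.map (λ_ (T.obj X)).hom ≫ T.μ.app X =
      δ (T.obj (𝟙_ M)) X ≫ T.μ.app (𝟙_ M) ▷ T.obj X ≫ η ▷ T.obj X ≫ (λ_ (T.obj X)).hom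
  tau_3 : ∀ X Y Z : M,
    X ◁ T.η.app (Y ⊗ Z) ≫ X ◁ δ Y Z ≫ (α_ X (T.obj Y) (T.obj Z)).inv ≫
        T.η.app (X ⊗ T.obj Y) ▷ T.obj Z ≫ δ X (T.obj Y) ▷ T.obj Z ≫
          (T.obj X ◁ T.μ.app Y) ▷ T.obj Z =
      (α_ X Y Z).inv ≫ T.η.app ((X ⊗ Y) ⊗ Z) ≫ δ (X ⊗ Y) Z ≫ δ X Y ▷ T.obj Z
  tau_4 : ∀ X Y Z : M,
    T.η.app (X ⊗ Y) ▷ Z ≫ δ X Y ▷ Z ≫ (α_ (T.obj X) (T.obj Y) Z).hom ≫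
        T.obj X ◁ T.η.app (T.obj Y ⊗ Z) ≫ T.obj X ◁ δ (T.obj Y) Z ≫
          T.obj X ◁ (T.μ.app Y ▷ T.obj Z) =
      T.η.app ((X ⊗ Y) ⊗ Z) ≫ δ (X ⊗ Y) Z ≫ δ X Y ▷ T.obj Z ≫
        (α_ (T.obj X) (T.obj Y) (T.obj Z)).hom
  tau_5 : ∀ X Y : M,
    T.map (δ X Y) ≫ δ (T.obj X) (T.obj Y) ≫ (T.μ.app X ⊗ₘ T.μ.app Y) =
      T.μ.app (X ⊗ Y) ≫ δ X Y

/-! Write `F ⊣ U` for the free-forgetful adjunction of `T`. If `U` is monoidal, then `F` is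
opmonoidal by passing to mates, and the opmonoidal structure of `U` makes `T = UF` opmonoidal; its
components are `tau` and `tauZero`. Conditions 1 and 2 say that certain maps out of free algebras
are algebra morphisms, 3 and 4 encode the Frobenius identities, and 5 encodes separability.

The data can be recovered because they split idempotents that `tau` and `tauZero` determine: `p`
followed by `i` is the unit of `T`, then `tau`, then the two actions (`proj_incl`), and the unit
algebra is a retract of `TK` with a known idempotent (`unitProj_unitIncl`). Equal data therefore
give splittings of the same idempotents, hence a comparison isomorphism. Compatibility with all
constraints, and uniqueness, are checked after precomposing with the split epimorphisms.

Conversely, let `τ` satisfy 1–5. By 5, `τ` followed by two actions is an associative, possibly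
non-unital action on `A ⊗ B`; acting on the unit gives an idempotent, and its splitting is the
tensor product of algebras (`IsAssocAction.exists_split`). Via `τ₀` the object `TK` acts on both
sides of every algebra; 1 and 2 make these actions equivariant, and the tensor product is balanced
over them (`rightAct_actionIdem`). The effective quotient of `TK` is the unit algebra, and
balancedness makes the unit constraints invertible. Finally 3 and 4 give the Frobenius identities.
-/

/-! ### Units and counits of monoidal adjunctions. -/

namespace CategoryTheory.Adjunction

variable {M : Type u} [Category.{v} M] {N : Type u'} [Category.{v'} N] {F : M ⥤ N} {U : N ⥤ M}
  (adj : F ⊣ U)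

/-- The components of the unit of an adjunction, as morphisms between plain objects. -/
def unitHom (X : M) : X ⟶ U.obj (F.obj X) := adj.unit.app X

/-- The components of the counit of an adjunction, as morphisms between plain objects. -/
def counitHom (A : N) : F.obj (U.obj A) ⟶ A := adj.counit.app A

lemma unitHom_naturality {X Y : M} (f : X ⟶ Y) :
    f ≫ adj.unitHom Y = adj.unitHom X ≫ U.map (F.map f) := adj.unit.naturality f

lemma counitHom_naturality {A B : N} (f : A ⟶ B) :
    F.map (U.map f) ≫ adj.counitHom B = adj.counitHom A ≫ f := adj.counit.naturality f

lemma unitHom_comp_map_counitHom (A : N) :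
    adj.unitHom (U.obj A) ≫ U.map (adj.counitHom A) = 𝟙 _ := adj.right_triangle_components A

lemma map_unitHom_comp_counitHom (X : M) :
    F.map (adj.unitHom X) ≫ adj.counitHom (F.obj X) = 𝟙 _ := adj.left_triangle_components X

/-- A morphism out of a free object is recovered from its restriction along the unit. The two unit
conditions are instances of this. -/
lemma map_unitHom_map_counitHom {X : M} {A : N} (g : F.obj X ⟶ A) :
    U.map (F.map (adj.unitHom X)) ≫ U.map (F.map (U.map g)) ≫ U.map (adj.counitHom A) =
      U.map g := by
  rw [← U.map_comp, counitHom_naturality, U.map_comp, ← U.map_comp_assoc,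
    map_unitHom_comp_counitHom, U.map_id, Category.id_comp]

variable [MonoidalCategory M] [MonoidalCategory N] [F.OplaxMonoidal] [U.LaxMonoidal]
  [adj.IsMonoidal]

lemma unitHom_comp_map_δ (X Y : M) :
    adj.unitHom (X ⊗ Y) ≫ U.map (δ F X Y) =
      (adj.unitHom X ⊗ₘ adj.unitHom Y) ≫ μ U (F.obj X) (F.obj Y) :=
  adj.unit_app_tensor_comp_map_δ X Y

lemma map_μ_comp_counitHom (A B : N) :
    F.map (μ U A B) ≫ adj.counitHom (A ⊗ B) =
      δ F (U.obj A) (U.obj B) ≫ (adj.counitHom A ⊗ₘ adj.counitHom B) :=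
  adj.map_μ_comp_counit_app_tensor A B

end CategoryTheory.Adjunction

/-! ### Consequences of a separable Frobenius right adjoint. -/

namespace SeparableFrobenius

attribute [simp] separable

variable {M : Type u} [Category.{v} M] [MonoidalCategory M]
  {N : Type u'} [Category.{v'} N] [MonoidalCategory N] {F : M ⥤ N} {U : N ⥤ M} (adj : F ⊣ U)
  [F.OplaxMonoidal] [SeparableFrobenius U]

/-- Naturality and counitality of `δ U` exhibit the right-hand side as `U` of a morphism out of a
free object, which `map_unitHom_map_counitHom` recovers from its restriction along the unit. -/
lemma right_unit_condition (X : M) :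
    U.map (F.map (adj.unitHom (X ⊗ U.obj (F.obj (𝟙_ M))))) ≫
      U.map (F.map (U.map (δ F X (U.obj (F.obj (𝟙_ M)))) ≫ δ U _ _)) ≫
      U.map (F.map (U.obj (F.obj X) ◁ U.map (adj.counitHom (F.obj (𝟙_ M))))) ≫
      U.map (F.map (U.obj (F.obj X) ◁ (U.map (η F) ≫ η U))) ≫
      U.map (F.map (ρ_ (U.obj (F.obj X))).hom) ≫ U.map (adj.counitHom (F.obj X)) =
    (U.map (δ F X (U.obj (F.obj (𝟙_ M)))) ≫ δ U _ _) ≫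
      U.obj (F.obj X) ◁ U.map (adj.counitHom (F.obj (𝟙_ M))) ≫
      U.obj (F.obj X) ◁ (U.map (η F) ≫ η U) ≫ (ρ_ (U.obj (F.obj X))).hom := by
  have h : (U.map (δ F X (U.obj (F.obj (𝟙_ M)))) ≫ δ U _ _) ≫
      U.obj (F.obj X) ◁ U.map (adj.counitHom (F.obj (𝟙_ M))) ≫
      U.obj (F.obj X) ◁ (U.map (η F) ≫ η U) ≫ (ρ_ (U.obj (F.obj X))).hom =
      U.map (δ F X (U.obj (F.obj (𝟙_ M))) ≫ F.obj X ◁ adj.counitHom (F.obj (𝟙_ M)) ≫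
        F.obj X ◁ η F ≫ (ρ_ (F.obj X)).hom) := by
    simp [-Functor.LaxMonoidal.right_unitality, right_unitality_hom]
  conv_rhs => rw [h, ← adj.map_unitHom_map_counitHom, ← h]
  simp only [Functor.map_comp, Category.assoc]

lemma left_unit_condition (X : M) :
    U.map (F.map (adj.unitHom (U.obj (F.obj (𝟙_ M)) ⊗ X))) ≫
      U.map (F.map (U.map (δ F (U.obj (F.obj (𝟙_ M))) X) ≫ δ U _ _)) ≫
      U.map (F.map (U.map (adj.counitHom (F.obj (𝟙_ M))) ▷ U.obj (F.obj X))) ≫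
      U.map (F.map ((U.map (η F) ≫ η U) ▷ U.obj (F.obj X))) ≫
      U.map (F.map (λ_ (U.obj (F.obj X))).hom) ≫ U.map (adj.counitHom (F.obj X)) =
    (U.map (δ F (U.obj (F.obj (𝟙_ M))) X) ≫ δ U _ _) ≫
      U.map (adj.counitHom (F.obj (𝟙_ M))) ▷ U.obj (F.obj X) ≫
      (U.map (η F) ≫ η U) ▷ U.obj (F.obj X) ≫ (λ_ (U.obj (F.obj X))).hom := by
  have h : (U.map (δ F (U.obj (F.obj (𝟙_ M))) X) ≫ δ U _ _) ≫
      U.map (adj.counitHom (F.obj (𝟙_ M))) ▷ U.obj (F.obj X) ≫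
      (U.map (η F) ≫ η U) ▷ U.obj (F.obj X) ≫ (λ_ (U.obj (F.obj X))).hom =
      U.map (δ F (U.obj (F.obj (𝟙_ M))) X ≫ adj.counitHom (F.obj (𝟙_ M)) ▷ F.obj X ≫
        η F ▷ F.obj X ≫ (λ_ (F.obj X)).hom) := by
    simp [-Functor.LaxMonoidal.left_unitality, left_unitality_hom]
  conv_rhs => rw [h, ← adj.map_unitHom_map_counitHom, ← h]
  simp only [Functor.map_comp, Category.assoc]

variable [adj.IsMonoidal]

/-- Naturality of `δ U` and monoidality of the counit. For algebras this relates the action built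
from `τ` to the action on the tensor product, through `p` and `i`. -/
lemma δ_comp_counitHom (A B : N) :
    U.map (δ F (U.obj A) (U.obj B)) ≫ δ U _ _ ≫
      (U.map (adj.counitHom A) ⊗ₘ U.map (adj.counitHom B)) =
    U.map (F.map (μ U A B)) ≫ U.map (adj.counitHom (A ⊗ B)) ≫ δ U A B := by
  rw [δ_natural, ← Functor.map_comp_assoc, ← adj.map_μ_comp_counitHom, Functor.map_comp_assoc]

/-- The idempotent split by the tensor product thus depends only on `τ` and the two actions. -/
lemma unitHom_comp_δ_comp_counitHom (A B : N) :
    adj.unitHom (U.obj A ⊗ U.obj B) ≫ U.map (δ F (U.obj A) (U.obj B)) ≫ δ U _ _ ≫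
      (U.map (adj.counitHom A) ⊗ₘ U.map (adj.counitHom B)) = μ U A B ≫ δ U A B := by
  rw [δ_comp_counitHom, ← reassoc_of% adj.unitHom_naturality,
    reassoc_of% adj.unitHom_comp_map_counitHom]

lemma unitHom_comp_δ_comp_counitHom_right (X : M) (B : N) :
    adj.unitHom (X ⊗ U.obj B) ≫ U.map (δ F X (U.obj B)) ≫ δ U _ _ ≫
      U.obj (F.obj X) ◁ U.map (adj.counitHom B) =
    adj.unitHom X ▷ U.obj B ≫ μ U (F.obj X) B ≫ δ U (F.obj X) B := by
  rw [δ_natural_right, reassoc_of% adj.unitHom_comp_map_δ, ← μ_natural_right_assoc, ← id_tensorHom,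
    tensorHom_comp_tensorHom_assoc, adj.unitHom_comp_map_counitHom, Category.comp_id, tensorHom_id]

lemma unitHom_comp_δ_comp_counitHom_left (A : N) (Y : M) :
    adj.unitHom (U.obj A ⊗ Y) ≫ U.map (δ F (U.obj A) Y) ≫ δ U _ _ ≫
      U.map (adj.counitHom A) ▷ U.obj (F.obj Y) =
    U.obj A ◁ adj.unitHom Y ≫ μ U A (F.obj Y) ≫ δ U A (F.obj Y) := by
  rw [δ_natural_left, reassoc_of% adj.unitHom_comp_map_δ, ← μ_natural_left_assoc, ← tensorHom_id,
    tensorHom_comp_tensorHom_assoc, adj.unitHom_comp_map_counitHom, Category.comp_id, id_tensorHom]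

lemma whiskerRight_δ_condition (X Y Z : M) :
    adj.unitHom ((X ⊗ Y) ⊗ Z) ≫ (U.map (δ F (X ⊗ Y) Z) ≫ δ U _ _) ≫
      (U.map (δ F X Y) ≫ δ U _ _) ▷ U.obj (F.obj Z) =
    ((adj.unitHom X ⊗ₘ adj.unitHom Y) ⊗ₘ adj.unitHom Z) ≫ μ U _ _ ▷ _ ≫ μ U _ _ ≫
      δ U (F.obj X ⊗ F.obj Y) (F.obj Z) ≫ δ U _ _ ▷ _ := by
  rw [comp_whiskerRight, Category.assoc, δ_natural_left_assoc, reassoc_of% adj.unitHom_comp_map_δ,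
    ← μ_natural_left_assoc, ← tensorHom_id, tensorHom_comp_tensorHom_assoc, adj.unitHom_comp_map_δ,
    ← tensorHom_comp_tensorHom_assoc, tensorHom_id]

/-- The mate formulas rewrite both sides in terms of `μ U` and `δ U`; what remains is the first
Frobenius identity and associativity of `μ U`. -/
lemma frobenius_left_condition (X Y Z : M) :
    X ◁ adj.unitHom (Y ⊗ Z) ≫ X ◁ (U.map (δ F Y Z) ≫ δ U _ _) ≫ (α_ X _ _).inv ≫
      adj.unitHom (X ⊗ U.obj (F.obj Y)) ▷ U.obj (F.obj Z) ≫
      (U.map (δ F X (U.obj (F.obj Y))) ≫ δ U _ _) ▷ U.obj (F.obj Z) ≫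
      (U.obj (F.obj X) ◁ U.map (adj.counitHom (F.obj Y))) ▷ U.obj (F.obj Z) =
    (α_ X Y Z).inv ≫ adj.unitHom ((X ⊗ Y) ⊗ Z) ≫ (U.map (δ F (X ⊗ Y) Z) ≫ δ U _ _) ≫
      (U.map (δ F X Y) ≫ δ U _ _) ▷ U.obj (F.obj Z) := by
  rw [← comp_whiskerRight, ← comp_whiskerRight, Category.assoc,
    unitHom_comp_δ_comp_counitHom_right, ← MonoidalCategory.whiskerLeft_comp_assoc,
    reassoc_of% adj.unitHom_comp_map_δ, whiskerRight_δ_condition]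
  simp only [comp_whiskerRight, MonoidalCategory.whiskerLeft_comp, Category.assoc]
  rw [← associator_inv_naturality_left_assoc, whisker_exchange_assoc, whisker_exchange_assoc,
    whisker_exchange_assoc, reassoc_of% frobenius_left, Functor.LaxMonoidal.associativity_inv_assoc,
    ← associator_inv_naturality_assoc, tensorHom_def_assoc (adj.unitHom X)]

/-- The mirror argument, with the second Frobenius identity and coassociativity of `δ U`. -/
lemma frobenius_right_condition (X Y Z : M) :
    adj.unitHom (X ⊗ Y) ▷ Z ≫ (U.map (δ F X Y) ≫ δ U _ _) ▷ Z ≫ (α_ _ _ Z).hom ≫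
      U.obj (F.obj X) ◁ adj.unitHom (U.obj (F.obj Y) ⊗ Z) ≫
      U.obj (F.obj X) ◁ (U.map (δ F (U.obj (F.obj Y)) Z) ≫ δ U _ _) ≫
      U.obj (F.obj X) ◁ (U.map (adj.counitHom (F.obj Y)) ▷ U.obj (F.obj Z)) =
    adj.unitHom ((X ⊗ Y) ⊗ Z) ≫ (U.map (δ F (X ⊗ Y) Z) ≫ δ U _ _) ≫
      (U.map (δ F X Y) ≫ δ U _ _) ▷ U.obj (F.obj Z) ≫ (α_ _ _ _).hom := by
  have h := (reassoc_of% whiskerRight_δ_condition adj X Y Z) (α_ _ _ _).hom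
  simp only [Category.assoc] at h ⊢
  rw [h, ← MonoidalCategory.whiskerLeft_comp, ← MonoidalCategory.whiskerLeft_comp, Category.assoc,
    unitHom_comp_δ_comp_counitHom_left, ← comp_whiskerRight_assoc,
    reassoc_of% adj.unitHom_comp_map_δ, Functor.OplaxMonoidal.associativity]
  simp only [comp_whiskerRight, MonoidalCategory.whiskerLeft_comp, Category.assoc]
  rw [← associator_naturality_right_assoc, ← whisker_exchange_assoc, ← whisker_exchange_assoc,
    reassoc_of% frobenius_right, tensorHom_def_assoc _ (adj.unitHom Z)]

/-- Separability enters here: `δ U` followed by `μ U` appears under `F` and cancels, leaving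
naturality of the counit. -/
lemma mul_condition (X Y : M) :
    U.map (F.map (U.map (δ F X Y) ≫ δ U _ _)) ≫
      (U.map (δ F (U.obj (F.obj X)) (U.obj (F.obj Y))) ≫ δ U _ _) ≫
      (U.map (adj.counitHom (F.obj X)) ⊗ₘ U.map (adj.counitHom (F.obj Y))) =
    U.map (adj.counitHom (F.obj (X ⊗ Y))) ≫ U.map (δ F X Y) ≫ δ U _ _ := by
  rw [Category.assoc, δ_comp_counitHom, ← U.map_comp_assoc, ← F.map_comp, Category.assoc, separable,
    Category.comp_id, ← U.map_comp_assoc, adj.counitHom_naturality, U.map_comp_assoc]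

/-- The section of `U.map (η F)`, witnessing that the monoidal unit is a retract of the free object
on the monoidal unit. -/
def unitSection : U.obj (𝟙_ N) ⟶ U.obj (F.obj (𝟙_ M)) :=
  (λ_ _).inv ≫ adj.unitHom (𝟙_ M) ▷ _ ≫ μ U (F.obj (𝟙_ M)) (𝟙_ N) ≫ U.map (ρ_ _).hom

/-- Sliding `η F` to the front turns the unit of the adjunction into `ε U`; what is left is
unitality of `U`, as both unitors agree at the unit object. -/
lemma unitSection_comp_map_η : unitSection adj ≫ U.map (η F) = 𝟙 _ := by
  have h : adj.unitHom (𝟙_ M) ≫ U.map (η F) = ε U := adj.unit_app_unit_comp_map_η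
  rw [unitSection, Category.assoc, Category.assoc, Category.assoc, ← U.map_comp,
    ← rightUnitor_naturality, U.map_comp, ← μ_natural_left_assoc, ← comp_whiskerRight_assoc, h,
    ← unitors_equal, ← Functor.LaxMonoidal.left_unitality, Iso.inv_hom_id]

lemma whiskerLeft_map_η_comp_μ (A : N) :
    U.obj A ◁ U.map (η F) ≫ μ U A (𝟙_ N) ≫ U.map (ρ_ A).hom =
      μ U A (F.obj (𝟙_ M)) ≫ δ U _ _ ≫ U.obj A ◁ (U.map (η F) ≫ η U) ≫ (ρ_ _).hom := by
  rw [MonoidalCategory.whiskerLeft_comp, Category.assoc, δ_natural_right_assoc,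
    right_unitality_hom, μ_natural_right_assoc]

lemma whiskerRight_map_η_comp_μ (A : N) :
    U.map (η F) ▷ U.obj A ≫ μ U (𝟙_ N) A ≫ U.map (λ_ A).hom =
      μ U (F.obj (𝟙_ M)) A ≫ δ U _ _ ≫ (U.map (η F) ≫ η U) ▷ U.obj A ≫ (λ_ _).hom := by
  rw [comp_whiskerRight, Category.assoc, δ_natural_left_assoc,
    left_unitality_hom, μ_natural_left_assoc]

/-- This expresses the idempotent on `TK` with image the unit algebra through `τ` and `τ₀` alone, so
that they determine the unit algebra. -/
lemma map_η_comp_unitSection :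
    U.map (η F) ≫ unitSection adj = (λ_ _).inv ≫ adj.unitHom (𝟙_ M ⊗ U.obj (F.obj (𝟙_ M))) ≫
      (U.map (δ F (𝟙_ M) (U.obj (F.obj (𝟙_ M)))) ≫ δ U _ _) ≫
      U.obj (F.obj (𝟙_ M)) ◁ U.map (adj.counitHom (F.obj (𝟙_ M))) ≫
      U.obj (F.obj (𝟙_ M)) ◁ (U.map (η F) ≫ η U) ≫ (ρ_ _).hom := by
  rw [Category.assoc, reassoc_of% unitHom_comp_δ_comp_counitHom_right, unitSection,
    leftUnitor_inv_naturality_assoc, whisker_exchange_assoc, whiskerLeft_map_η_comp_μ]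

lemma whiskerRight_map_η_comp_μ_eq (A : N) :
    U.map (η F) ▷ U.obj A ≫ μ U (𝟙_ N) A ≫ U.map (λ_ A).hom =
      adj.unitHom (U.obj (F.obj (𝟙_ M)) ⊗ U.obj A) ≫
      (U.map (δ F (U.obj (F.obj (𝟙_ M))) (U.obj A)) ≫ δ U _ _) ≫
      (U.map (adj.counitHom (F.obj (𝟙_ M))) ⊗ₘ U.map (adj.counitHom A)) ≫
      (U.map (η F) ≫ η U) ▷ U.obj A ≫ (λ_ _).hom := by
  rw [Category.assoc, reassoc_of% unitHom_comp_δ_comp_counitHom, whiskerRight_map_η_comp_μ]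

lemma whiskerLeft_map_η_comp_μ_eq (A : N) :
    U.obj A ◁ U.map (η F) ≫ μ U A (𝟙_ N) ≫ U.map (ρ_ A).hom =
      adj.unitHom (U.obj A ⊗ U.obj (F.obj (𝟙_ M))) ≫
      (U.map (δ F (U.obj A) (U.obj (F.obj (𝟙_ M)))) ≫ δ U _ _) ≫
      (U.map (adj.counitHom A) ⊗ₘ U.map (adj.counitHom (F.obj (𝟙_ M)))) ≫
      U.obj A ◁ (U.map (η F) ≫ η U) ≫ (ρ_ _).hom := by
  rw [Category.assoc, reassoc_of% unitHom_comp_δ_comp_counitHom, whiskerLeft_map_η_comp_μ]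

end SeparableFrobenius

/-! ### The opmonoidal structure of a weak bimonad. -/

namespace WeakBimonadStructure

variable {M : Type u} [Category.{v} M] [MonoidalCategory M] {T : Monad M}
  (W : WeakBimonadStructure T)

/-- The free algebra functor. -/
def free : M ⥤ W.Alg := T.free

/-- The free-forgetful adjunction. -/
def adj : W.free ⊣ W.forget := T.adj

/-- The opmonoidal structure on the free algebra functor. -/
instance : W.free.OplaxMonoidal := W.adj.leftAdjointOplaxMonoidal

instance : W.adj.IsMonoidal :=
  inferInstanceAs (letI := W.adj.leftAdjointOplaxMonoidal; W.adj.IsMonoidal)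

lemma unitHom_adj (X : M) : W.adj.unitHom X = T.η.app X :=
  congr_arg (fun f => NatTrans.app f X) T.adj_unit

lemma map_counitHom_adj (A : W.Alg) : W.forget.map (W.adj.counitHom A) = W.act A := by
  change (T.adj.counit.app A).f = _
  rw [T.adj_counit]
  rfl

lemma map_counitHom_free (X : M) :
    W.forget.map (W.adj.counitHom (W.free.obj X)) = T.μ.app X :=
  W.map_counitHom_adj (W.free.obj X)

lemma map_η_free_eq : W.forget.map (η W.free) = T.map (ε W.forget) ≫ W.act (𝟙_ W.Alg) := by
  have h : η W.free = W.free.map (ε W.forget) ≫ W.adj.counitHom (𝟙_ W.Alg) :=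
    W.adj.homEquiv_counit _ _ _
  rw [h, Functor.map_comp, map_counitHom_adj]
  rfl

lemma tauZero_eq : W.tauZero = W.forget.map (η W.free) ≫ η W.forget := by
  rw [map_η_free_eq]
  exact (Category.assoc _ _ _).symm

lemma tau_eq (X Y : M) :
    W.tau X Y = W.forget.map (δ W.free X Y) ≫ δ W.forget (W.free.obj X) (W.free.obj Y) := by
  have h : δ W.free X Y = W.free.map ((W.adj.unitHom X ⊗ₘ W.adj.unitHom Y) ≫ μ W.forget _ _) ≫
      W.adj.counitHom (W.free.obj X ⊗ W.free.obj Y) :=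
    W.adj.homEquiv_counit _ _ _
  rw [h, Functor.map_comp, Functor.map_comp, Functor.map_comp, Category.assoc, Category.assoc,
    map_counitHom_adj, unitHom_adj, unitHom_adj]
  rfl

variable (A B : W.Alg)

lemma map_μ_comp_act_comp_δ :
    T.map (μ W.forget A B) ≫ W.act (A ⊗ B) ≫ δ W.forget A B =
      W.tau (W.forget.obj A) (W.forget.obj B) ≫ (W.act A ⊗ₘ W.act B) := by
  have h := SeparableFrobenius.δ_comp_counitHom W.adj A B
  rw [← Category.assoc, ← tau_eq, map_counitHom_adj, map_counitHom_adj, map_counitHom_adj] at h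
  exact h.symm

lemma μ_comp_δ : μ W.forget A B ≫ δ W.forget A B =
    T.η.app (W.forget.obj A ⊗ W.forget.obj B) ≫ W.tau (W.forget.obj A) (W.forget.obj B) ≫
      (W.act A ⊗ₘ W.act B) := by
  have h := SeparableFrobenius.unitHom_comp_δ_comp_counitHom W.adj A B
  rw [← Category.assoc (W.forget.map _), ← tau_eq, map_counitHom_adj, map_counitHom_adj,
    unitHom_adj] at h
  exact h.symm

lemma map_η_free_comp_leftUnitor :
    W.forget.map (η W.free) ▷ W.forget.obj A ≫ μ W.forget (𝟙_ W.Alg) A ≫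
        W.forget.map (λ_ A).hom =
      T.η.app (T.obj (𝟙_ M) ⊗ W.forget.obj A) ≫ W.tau (T.obj (𝟙_ M)) (W.forget.obj A) ≫
        (T.μ.app (𝟙_ M) ⊗ₘ W.act A) ≫ W.tauZero ▷ W.forget.obj A ≫ (λ_ _).hom := by
  have h := SeparableFrobenius.whiskerRight_map_η_comp_μ_eq W.adj A
  rw [← tau_eq, ← tauZero_eq, map_counitHom_free, map_counitHom_adj, unitHom_adj] at h
  exact h

lemma map_η_free_comp_rightUnitor :
    W.forget.obj A ◁ W.forget.map (η W.free) ≫ μ W.forget A (𝟙_ W.Alg) ≫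
        W.forget.map (ρ_ A).hom =
      T.η.app (W.forget.obj A ⊗ T.obj (𝟙_ M)) ≫ W.tau (W.forget.obj A) (T.obj (𝟙_ M)) ≫
        (W.act A ⊗ₘ T.μ.app (𝟙_ M)) ≫ W.forget.obj A ◁ W.tauZero ≫ (ρ_ _).hom := by
  have h := SeparableFrobenius.whiskerLeft_map_η_comp_μ_eq W.adj A
  rw [← tau_eq, ← tauZero_eq, map_counitHom_free, map_counitHom_adj, unitHom_adj] at h
  exact h

/-- The opmonoidal structure on `T` determined by a weak bimonad structure. -/
def toCompatible : CompatibleOpmonoidalStructure T where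
  -- Copying the composite structure makes its components equal by definition to `tauZero` and
  -- `tau`.
  toOplaxMonoidal := Functor.OplaxMonoidal.copy (F := T.toFunctor)
    (inferInstanceAs (W.free ⋙ W.forget).OplaxMonoidal) W.tauZero W.tau
    W.tauZero_eq (by ext X Y; exact W.tau_eq X Y)
  tau_1 X := by
    have h := SeparableFrobenius.right_unit_condition W.adj X
    rw [← tau_eq, ← tauZero_eq, map_counitHom_free, map_counitHom_free, unitHom_adj] at h
    exact h
  tau_2 X := by
    have h := SeparableFrobenius.left_unit_condition W.adj X
    rw [← tau_eq, ← tauZero_eq, map_counitHom_free, map_counitHom_free, unitHom_adj] at h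
    exact h
  tau_3 X Y Z := by
    have h := SeparableFrobenius.frobenius_left_condition W.adj X Y Z
    rw [← tau_eq, ← tau_eq, ← tau_eq, ← tau_eq, map_counitHom_free, unitHom_adj, unitHom_adj,
      unitHom_adj] at h
    exact h
  tau_4 X Y Z := by
    have h := SeparableFrobenius.frobenius_right_condition W.adj X Y Z
    rw [← tau_eq, ← tau_eq, ← tau_eq, map_counitHom_free, unitHom_adj, unitHom_adj,
      unitHom_adj] at h
    exact h
  tau_5 X Y := by
    have h := SeparableFrobenius.mul_condition W.adj X Y
    rw [← tau_eq, ← tau_eq, map_counitHom_free, map_counitHom_free, map_counitHom_free] at h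
    exact h

end WeakBimonadStructure

/-! ### Isomorphisms of weak bimonad structures and their uniqueness. -/

instance isSplitEpi_whiskerRight {M : Type u} [Category.{v} M] [MonoidalCategory M] {X Y : M}
    (f : X ⟶ Y) [IsSplitEpi f] (Z : M) : IsSplitEpi (f ▷ Z) :=
  ⟨⟨section_ f ▷ Z, by rw [← comp_whiskerRight, IsSplitEpi.id, id_whiskerRight]⟩⟩

instance isSplitEpi_whiskerLeft {M : Type u} [Category.{v} M] [MonoidalCategory M] {X Y : M}
    (f : X ⟶ Y) [IsSplitEpi f] (Z : M) : IsSplitEpi (Z ◁ f) :=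
  ⟨⟨Z ◁ section_ f, by
    rw [← MonoidalCategory.whiskerLeft_comp, IsSplitEpi.id, MonoidalCategory.whiskerLeft_id]⟩⟩

namespace WeakBimonadStructure

variable {M : Type u} [Category.{v} M] [MonoidalCategory M] {T : Monad M}
  (W W' : WeakBimonadStructure T)

/-- The tensor product of algebras, as a plain operation. -/
def tensor (A B : T.Algebra) : T.Algebra := W.monoidal.tensorObj A B

/-- The monoidal unit, as a plain algebra. -/
def unitAlg : T.Algebra := W.monoidal.tensorUnit

/-- The left whiskering of algebra morphisms, as a plain operation. -/
def whiskerL (A : T.Algebra) {B C : T.Algebra} (f : B ⟶ C) : W.tensor A B ⟶ W.tensor A C :=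
  W.monoidal.whiskerLeft A f

/-- The right whiskering of algebra morphisms, as a plain operation. -/
def whiskerR {A B : T.Algebra} (f : A ⟶ B) (C : T.Algebra) : W.tensor A C ⟶ W.tensor B C :=
  W.monoidal.whiskerRight f C

/-- The associativity constraint, as a plain algebra isomorphism. -/
def assocIso (A B C : T.Algebra) : W.tensor (W.tensor A B) C ≅ W.tensor A (W.tensor B C) :=
  W.monoidal.associator A B C

/-- The left unit constraint, as a plain algebra isomorphism. -/
def leftIso (A : T.Algebra) : W.tensor W.unitAlg A ≅ A := W.monoidal.leftUnitor A

/-- The right unit constraint, as a plain algebra isomorphism. -/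
def rightIso (A : T.Algebra) : W.tensor A W.unitAlg ≅ A := W.monoidal.rightUnitor A

/-- The monoidal structure `p` of the forgetful functor. -/
def proj (A B : T.Algebra) : A.A ⊗ B.A ⟶ (W.tensor A B).A := W.frobenius.μ A B

/-- The opmonoidal structure `i` of the forgetful functor. -/
def incl (A B : T.Algebra) : (W.tensor A B).A ⟶ A.A ⊗ B.A := W.frobenius.δ A B

/-- The nullary part of the monoidal structure of the forgetful functor. -/
def unitIn : 𝟙_ M ⟶ W.unitAlg.A := W.frobenius.ε

/-- The nullary part of the opmonoidal structure of the forgetful functor. -/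
def unitOut : W.unitAlg.A ⟶ 𝟙_ M := W.frobenius.η

/-- The algebra morphism from the free algebra on the unit to the monoidal unit. -/
def unitProj : T.obj (𝟙_ M) ⟶ W.unitAlg.A := W.forget.map (η W.free)

/-- A section of `unitProj`. -/
def unitIncl : W.unitAlg.A ⟶ T.obj (𝟙_ M) := SeparableFrobenius.unitSection W.adj

variable {A B C : T.Algebra}

lemma whiskerR_proj (f : A ⟶ B) (C : T.Algebra) :
    f.f ▷ C.A ≫ W.proj B C = W.proj A C ≫ (W.whiskerR f C).f :=
  μ_natural_left W.forget (X := A) (Y := B) f C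

lemma whiskerL_proj (A : T.Algebra) (f : B ⟶ C) :
    A.A ◁ f.f ≫ W.proj A C = W.proj A B ≫ (W.whiskerL A f).f :=
  μ_natural_right W.forget (X := B) (Y := C) A f

lemma assocIso_proj (A B C : T.Algebra) :
    W.proj A B ▷ C.A ≫ W.proj (W.tensor A B) C ≫ (W.assocIso A B C).hom.f =
      (α_ A.A B.A C.A).hom ≫ A.A ◁ W.proj B C ≫ W.proj A (W.tensor B C) :=
  Functor.LaxMonoidal.associativity W.forget A B C

@[simp]
lemma incl_proj (A B : T.Algebra) : W.incl A B ≫ W.proj A B = 𝟙 (W.tensor A B).A :=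
  W.frobenius.separable A B

lemma proj_a_incl (A B : T.Algebra) :
    T.map (W.proj A B) ≫ (W.tensor A B).a ≫ W.incl A B = W.tau A.A B.A ≫ (A.a ⊗ₘ B.a) :=
  W.map_μ_comp_act_comp_δ A B

lemma proj_incl (A B : T.Algebra) :
    W.proj A B ≫ W.incl A B = T.η.app (A.A ⊗ B.A) ≫ W.tau A.A B.A ≫ (A.a ⊗ₘ B.a) :=
  W.μ_comp_δ A B

lemma unitProj_def : W.unitProj = T.map W.unitIn ≫ W.unitAlg.a := W.map_η_free_eq

@[simp]
lemma unitIncl_unitProj : W.unitIncl ≫ W.unitProj = 𝟙 W.unitAlg.A :=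
  SeparableFrobenius.unitSection_comp_map_η W.adj

lemma unitProj_unitIncl :
    W.unitProj ≫ W.unitIncl = (λ_ _).inv ≫ T.η.app (𝟙_ M ⊗ T.obj (𝟙_ M)) ≫
      W.tau (𝟙_ M) (T.obj (𝟙_ M)) ≫ T.obj (𝟙_ M) ◁ T.μ.app (𝟙_ M) ≫
      T.obj (𝟙_ M) ◁ W.tauZero ≫ (ρ_ _).hom := by
  have h := SeparableFrobenius.map_η_comp_unitSection W.adj
  rw [← tau_eq, ← tauZero_eq, map_counitHom_free, unitHom_adj] at h
  exact h

lemma η_unitProj : T.η.app (𝟙_ M) ≫ W.unitProj = W.unitIn := by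
  have h : W.adj.unitHom (𝟙_ M) ≫ W.forget.map (η W.free) = ε W.forget :=
    W.adj.unit_app_unit_comp_map_η
  rw [unitHom_adj] at h
  exact h

lemma tauZero_eq_unitProj : W.tauZero = W.unitProj ≫ W.unitOut := W.tauZero_eq

lemma unitProj_h : T.map W.unitProj ≫ W.unitAlg.a = T.μ.app (𝟙_ M) ≫ W.unitProj :=
  Monad.Algebra.Hom.h (T := T) (A := T.free.obj (𝟙_ M)) (B := W.unitAlg) (η W.free)

/-- Since `unitProj ▷ A.A` and `proj` are split epimorphisms, this determines the left unit
constraint from `tau`, `tauZero` and the action. -/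
lemma unitProj_leftIso (A : T.Algebra) :
    W.unitProj ▷ A.A ≫ W.proj W.unitAlg A ≫ (W.leftIso A).hom.f =
      T.η.app (T.obj (𝟙_ M) ⊗ A.A) ≫ W.tau (T.obj (𝟙_ M)) A.A ≫ (T.μ.app (𝟙_ M) ⊗ₘ A.a) ≫
        W.tauZero ▷ A.A ≫ (λ_ _).hom :=
  W.map_η_free_comp_leftUnitor A

lemma unitProj_rightIso (A : T.Algebra) :
    A.A ◁ W.unitProj ≫ W.proj A W.unitAlg ≫ (W.rightIso A).hom.f =
      T.η.app (A.A ⊗ T.obj (𝟙_ M)) ≫ W.tau A.A (T.obj (𝟙_ M)) ≫ (A.a ⊗ₘ T.μ.app (𝟙_ M)) ≫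
        A.A ◁ W.tauZero ≫ (ρ_ _).hom :=
  W.map_η_free_comp_rightUnitor A

instance (A B : T.Algebra) : IsSplitEpi (W.proj A B) := ⟨⟨W.incl A B, W.incl_proj A B⟩⟩

instance (A B : T.Algebra) : IsSplitMono (W.incl A B) := ⟨⟨W.proj A B, W.incl_proj A B⟩⟩

instance : IsSplitEpi W.unitProj := ⟨⟨W.unitIncl, W.unitIncl_unitProj⟩⟩

section Iso

variable {W W'} (I : W.Iso W')

/-- The unit constraint of an isomorphism of weak bimonad structures. -/
def Iso.unitHom : W'.unitAlg ⟶ W.unitAlg := I.monoidal.ε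

/-- The counit constraint of an isomorphism of weak bimonad structures. -/
def Iso.unitInv : W.unitAlg ⟶ W'.unitAlg := I.monoidal.η

/-- The tensorator of an isomorphism of weak bimonad structures. -/
def Iso.tensorHom (A B : T.Algebra) : W'.tensor A B ⟶ W.tensor A B := I.monoidal.μ A B

/-- The cotensorator of an isomorphism of weak bimonad structures. -/
def Iso.tensorInv (A B : T.Algebra) : W.tensor A B ⟶ W'.tensor A B := I.monoidal.δ A B

lemma Iso.unitIn_unitHom : W'.unitIn ≫ I.unitHom.f = W.unitIn := I.ε_comp

lemma Iso.unitInv_unitOut : I.unitInv.f ≫ W'.unitOut = W.unitOut := I.comp_η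

lemma Iso.unitHom_unitInv : I.unitHom.f ≫ I.unitInv.f = 𝟙 _ :=
  congr_arg Monad.Algebra.Hom.f I.monoidal.ε_η

/-- An algebra morphism out of the free algebra on the unit is determined by its restriction to the
unit, so compatibility with `unitIn` suffices. -/
lemma Iso.unitProj_unitHom : W'.unitProj ≫ I.unitHom.f = W.unitProj := by
  rw [unitProj_def, unitProj_def, Category.assoc, ← Monad.Algebra.Hom.h, ← T.map_comp_assoc,
    I.unitIn_unitHom]

lemma Iso.proj_tensorHom (A B : T.Algebra) :
    W'.proj A B ≫ (I.tensorHom A B).f = W.proj A B :=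
  I.μ_comp A B

lemma Iso.tensorInv_incl (A B : T.Algebra) :
    (I.tensorInv A B).f ≫ W'.incl A B = W.incl A B :=
  I.comp_δ A B

lemma Iso.tensorHom_tensorInv (A B : T.Algebra) :
    (I.tensorHom A B).f ≫ (I.tensorInv A B).f = 𝟙 _ :=
  congr_arg Monad.Algebra.Hom.f (I.monoidal.μ_δ A B)

lemma Iso.tauZero_eq_tauZero (I : W.Iso W') : W.tauZero = W'.tauZero := by
  rw [tauZero_eq_unitProj, tauZero_eq_unitProj, ← I.unitProj_unitHom, ← I.unitInv_unitOut,
    Category.assoc, reassoc_of% I.unitHom_unitInv]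

/-- The comparison map is an algebra morphism, so it slides past the action and cancels against its
inverse. At free algebras this composite yields `tau`. -/
lemma Iso.proj_a_incl_eq (I : W.Iso W') (A B : T.Algebra) :
    T.map (W.proj A B) ≫ (W.tensor A B).a ≫ W.incl A B =
      T.map (W'.proj A B) ≫ (W'.tensor A B).a ≫ W'.incl A B := by
  rw [← I.proj_tensorHom, ← I.tensorInv_incl, T.map_comp, Category.assoc,
    Monad.Algebra.Hom.h_assoc, reassoc_of% I.tensorHom_tensorInv]

lemma Iso.tau_eq_tau (I : W.Iso W') (X Y : M) : W.tau X Y = W'.tau X Y :=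
  congr_arg (T.map (T.η.app X ⊗ₘ T.η.app Y) ≫ ·)
    (I.proj_a_incl_eq (T.free.obj X) (T.free.obj Y))

lemma Iso.unitHom_unique (I J : W.Iso W') : I.unitHom = J.unitHom := by
  ext
  rw [← cancel_epi W'.unitProj, I.unitProj_unitHom, J.unitProj_unitHom]

lemma Iso.tensorHom_unique (I J : W.Iso W') (A B : T.Algebra) :
    I.tensorHom A B = J.tensorHom A B := by
  ext
  rw [← cancel_epi (W'.proj A B), I.proj_tensorHom, J.proj_tensorHom]

instance : Subsingleton (W.Iso W') where
  allEq I J := by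
    have h : I.monoidal = J.monoidal := by
      -- A strong monoidal structure is determined by its lax part, whose components are fixed by
      -- precomposition with split epimorphisms.
      apply Functor.Monoidal.toLaxMonoidal_injective
      ext1
      · exact I.unitHom_unique J
      · funext A B
        exact I.tensorHom_unique J A B
    cases I
    cases J
    congr

end Iso

/-! ### Weak bimonad structures inducing the same opmonoidal structure. -/

section ofEq

variable {W W'}

/-- The comparison morphism between the tensor products of two weak bimonad structures. -/
def transfer (W W' : WeakBimonadStructure T) (A B : T.Algebra) :
    (W.tensor A B).A ⟶ (W'.tensor A B).A :=
  W.incl A B ≫ W'.proj A B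

lemma proj_incl_eq (h : W.tau = W'.tau) (A B : T.Algebra) :
    W.proj A B ≫ W.incl A B = W'.proj A B ≫ W'.incl A B := by
  rw [proj_incl, proj_incl, h]

lemma proj_transfer (h : W.tau = W'.tau) (A B : T.Algebra) :
    W.proj A B ≫ W.transfer W' A B = W'.proj A B := by
  rw [transfer, reassoc_of% proj_incl_eq h, incl_proj, Category.comp_id]

lemma transfer_incl (h : W.tau = W'.tau) (A B : T.Algebra) :
    W.transfer W' A B ≫ W'.incl A B = W.incl A B := by
  rw [transfer, Category.assoc, ← proj_incl_eq h, reassoc_of% incl_proj]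

lemma transfer_transfer (h : W.tau = W'.tau) (A B : T.Algebra) :
    W.transfer W' A B ≫ W'.transfer W A B = 𝟙 _ := by
  rw [← cancel_epi (W.proj A B), reassoc_of% proj_transfer h, proj_transfer h.symm,
    Category.comp_id]

/-- Not only the idempotents but also the composites of `p`, action and `i` depend on `tau` alone,
by `proj_a_incl`. -/
lemma transfer_h (h : W.tau = W'.tau) (A B : T.Algebra) :
    T.map (W.transfer W' A B) ≫ (W'.tensor A B).a =
      (W.tensor A B).a ≫ W.transfer W' A B := by
  rw [← cancel_mono (W'.incl A B), Category.assoc, Category.assoc, transfer_incl h, transfer,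
    T.map_comp, Category.assoc, proj_a_incl, ← h, ← proj_a_incl, ← T.map_comp_assoc, incl_proj,
    T.map_id, Category.id_comp]

/-- The comparison isomorphism between the tensor products of two weak bimonad structures. -/
def tensorIso (h : W.tau = W'.tau) (A B : T.Algebra) : W.tensor A B ≅ W'.tensor A B :=
  Monad.Algebra.isoMk ⟨W.transfer W' A B, W'.transfer W A B, transfer_transfer h A B,
    transfer_transfer h.symm A B⟩ (transfer_h h A B)

lemma proj_tensorIso (h : W.tau = W'.tau) (A B : T.Algebra) :
    W.proj A B ≫ (tensorIso h A B).hom.f = W'.proj A B :=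
  proj_transfer h A B

lemma unitProj_unitIncl_eq (h₀ : W.tauZero = W'.tauZero) (h : W.tau = W'.tau)
    :
    W.unitProj ≫ W.unitIncl = W'.unitProj ≫ W'.unitIncl := by
  rw [unitProj_unitIncl, unitProj_unitIncl, h, h₀]

lemma unitProj_unitTransfer (h₀ : W.tauZero = W'.tauZero) (h : W.tau = W'.tau)
    : W.unitProj ≫ W.unitIncl ≫ W'.unitProj = W'.unitProj := by
  rw [reassoc_of% unitProj_unitIncl_eq h₀ h, unitIncl_unitProj, Category.comp_id]

lemma unitTransfer_unitTransfer (h₀ : W.tauZero = W'.tauZero) (h : W.tau = W'.tau)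
    :
    (W.unitIncl ≫ W'.unitProj) ≫ W'.unitIncl ≫ W.unitProj = 𝟙 _ := by
  rw [← cancel_epi W.unitProj, Category.assoc, unitProj_unitTransfer h₀.symm h.symm,
    Category.comp_id, unitIncl_unitProj, Category.comp_id]

lemma unitTransfer_h (h₀ : W.tauZero = W'.tauZero) (h : W.tau = W'.tau)
    : T.map (W.unitIncl ≫ W'.unitProj) ≫ W'.unitAlg.a =
    W.unitAlg.a ≫ W.unitIncl ≫ W'.unitProj := by
  rw [← cancel_epi (T.map W.unitProj), ← T.map_comp_assoc, unitProj_unitTransfer h₀ h,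
    unitProj_h, reassoc_of% unitProj_h, unitProj_unitTransfer h₀ h]

/-- The comparison isomorphism between the units of two weak bimonad structures. -/
def unitIso (h₀ : W.tauZero = W'.tauZero) (h : W.tau = W'.tau)
    : W.unitAlg ≅ W'.unitAlg :=
  Monad.Algebra.isoMk ⟨W.unitIncl ≫ W'.unitProj, W'.unitIncl ≫ W.unitProj,
    unitTransfer_unitTransfer h₀ h, unitTransfer_unitTransfer h₀.symm h.symm⟩
    (unitTransfer_h h₀ h)

lemma unitProj_unitIso (h₀ : W.tauZero = W'.tauZero) (h : W.tau = W'.tau)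
    : W.unitProj ≫ (unitIso h₀ h).hom.f = W'.unitProj :=
  unitProj_unitTransfer h₀ h

lemma leftIso_compat (h₀ : W.tauZero = W'.tauZero) (h : W.tau = W'.tau)
    (A : T.Algebra) : (W.leftIso A).hom =
    W.whiskerR (unitIso h₀ h).hom A ≫ (tensorIso h W'.unitAlg A).hom ≫ (W'.leftIso A).hom := by
  ext
  rw [← cancel_epi (W.proj W.unitAlg A), ← cancel_epi (W.unitProj ▷ A.A), unitProj_leftIso,
    Monad.Algebra.comp_f, Monad.Algebra.comp_f, ← reassoc_of% whiskerR_proj,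
    reassoc_of% proj_tensorIso,
    ← comp_whiskerRight_assoc, unitProj_unitIso, unitProj_leftIso, h, h₀]

lemma rightIso_compat (h₀ : W.tauZero = W'.tauZero) (h : W.tau = W'.tau)
    (A : T.Algebra) : (W.rightIso A).hom =
    W.whiskerL A (unitIso h₀ h).hom ≫ (tensorIso h A W'.unitAlg).hom ≫ (W'.rightIso A).hom := by
  ext
  rw [← cancel_epi (W.proj A W.unitAlg), ← cancel_epi (A.A ◁ W.unitProj), unitProj_rightIso,
    Monad.Algebra.comp_f, Monad.Algebra.comp_f, ← reassoc_of% whiskerL_proj,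
    reassoc_of% proj_tensorIso,
    ← MonoidalCategory.whiskerLeft_comp_assoc, unitProj_unitIso, unitProj_rightIso, h, h₀]

lemma assocIso_compat (h : W.tau = W'.tau) (A B C : T.Algebra) :
    W.whiskerR (tensorIso h A B).hom C ≫ (tensorIso h (W'.tensor A B) C).hom ≫
      (W'.assocIso A B C).hom = (W.assocIso A B C).hom ≫ W.whiskerL A (tensorIso h B C).hom ≫
        (tensorIso h A (W'.tensor B C)).hom := by
  ext
  rw [← cancel_epi (W.proj (W.tensor A B) C), ← cancel_epi (W.proj A B ▷ C.A),
    Monad.Algebra.comp_f, Monad.Algebra.comp_f, Monad.Algebra.comp_f, Monad.Algebra.comp_f,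
    ← reassoc_of% whiskerR_proj, reassoc_of% proj_tensorIso, ← comp_whiskerRight_assoc,
    proj_tensorIso,
    assocIso_proj, reassoc_of% assocIso_proj, ← reassoc_of% whiskerL_proj, proj_tensorIso,
    ← MonoidalCategory.whiskerLeft_comp_assoc, proj_tensorIso]

lemma whiskerR_compat (h : W.tau = W'.tau) {A B : T.Algebra} (f : A ⟶ B) (C : T.Algebra) :
    W.whiskerR f C ≫ (tensorIso h B C).hom = (tensorIso h A C).hom ≫ W'.whiskerR f C := by
  ext
  rw [← cancel_epi (W.proj A C), Monad.Algebra.comp_f, Monad.Algebra.comp_f,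
    ← reassoc_of% whiskerR_proj, reassoc_of% proj_tensorIso, proj_tensorIso, whiskerR_proj]

lemma whiskerL_compat (h : W.tau = W'.tau) (A : T.Algebra) {B C : T.Algebra} (f : B ⟶ C) :
    W.whiskerL A f ≫ (tensorIso h A C).hom = (tensorIso h A B).hom ≫ W'.whiskerL A f := by
  ext
  rw [← cancel_epi (W.proj A B), Monad.Algebra.comp_f, Monad.Algebra.comp_f,
    ← reassoc_of% whiskerL_proj, reassoc_of% proj_tensorIso, proj_tensorIso, whiskerL_proj]

/-- The strong monoidal structure on the identity functor relating two weak bimonad structures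
that induce the same opmonoidal structure. -/
def coreMonoidal (h₀ : W.tauZero = W'.tauZero) (h : W.tau = W'.tau)
    : (idFunctor W' W).CoreMonoidal where
  εIso := unitIso h₀ h
  μIso A B := tensorIso h A B
  μIso_hom_natural_left f C := whiskerR_compat h f C
  μIso_hom_natural_right A f := whiskerL_compat h A f
  associativity A B C := assocIso_compat h A B C
  left_unitality A := leftIso_compat h₀ h A
  right_unitality A := rightIso_compat h₀ h A

/-- Weak bimonad structures that induce the same opmonoidal structure are isomorphic. -/
def isoOfEq (h₀ : W.tauZero = W'.tauZero) (h : W.tau = W'.tau)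
    : W'.Iso W where
  monoidal := (coreMonoidal h₀ h).toMonoidal
  ε_comp := by
    change W.unitIn ≫ (unitIso h₀ h).hom.f = W'.unitIn
    rw [← η_unitProj, ← η_unitProj, Category.assoc, unitProj_unitIso]
  μ_comp A B := proj_tensorIso h A B
  comp_η := by
    change (unitIso h₀ h).inv.f ≫ W.unitOut = W'.unitOut
    rw [← cancel_epi W'.unitProj, ← tauZero_eq_unitProj, ← h₀, tauZero_eq_unitProj,
      ← Category.assoc]
    congr 1
    exact unitProj_unitTransfer h₀.symm h.symm
  comp_δ A B := transfer_incl h.symm A B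

end ofEq

end WeakBimonadStructure

/-! ### Associative actions of a monad without the unit law. -/

namespace CategoryTheory.Monad

variable {M : Type u} [Category.{v} M] {T : Monad M}

/-- The components of the unit of a monad, as morphisms between plain objects. -/
def ηHom (T : Monad M) (X : M) : X ⟶ T.obj X := T.η.app X

/-- The components of the multiplication of a monad, as morphisms between plain objects. -/
def μHom (T : Monad M) (X : M) : T.obj (T.obj X) ⟶ T.obj X := T.μ.app X

variable (T) in
lemma comp_ηHom {X Y : M} (f : X ⟶ Y) : f ≫ T.ηHom Y = T.ηHom X ≫ T.map f := T.η.naturality f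

variable (T) in
lemma map_map_comp_μHom {X Y : M} (f : X ⟶ Y) :
    T.map (T.map f) ≫ T.μHom Y = T.μHom X ≫ T.map f := T.μ.naturality f

variable (T) in
@[simp]
lemma ηHom_comp_μHom (X : M) : T.ηHom (T.obj X) ≫ T.μHom X = 𝟙 _ := T.left_unit X

variable (T) in
@[simp]
lemma map_ηHom_comp_μHom (X : M) : T.map (T.ηHom X) ≫ T.μHom X = 𝟙 _ := T.right_unit X

variable (T) in
lemma map_μHom_comp_μHom (X : M) : T.map (T.μHom X) ≫ T.μHom X = T.μHom (T.obj X) ≫ T.μHom X :=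
  T.assoc X

variable {A B C : M} {a : T.obj A ⟶ A} {b : T.obj B ⟶ B} {c : T.obj C ⟶ C}

/-- A morphism compatible with given actions of a monad, which need not be unital. -/
def IsActionHom (a : T.obj A ⟶ A) (b : T.obj B ⟶ B) (f : A ⟶ B) : Prop :=
  T.map f ≫ b = a ≫ f

/-- Associativity of an action of a monad, which need not be unital. -/
def IsAssocAction (a : T.obj A ⟶ A) : Prop := T.μHom A ≫ a = T.map a ≫ a

/-- The idempotent associated to an associative action of a monad. -/
def actionIdem (a : T.obj A ⟶ A) : A ⟶ A := T.ηHom A ≫ a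

lemma Algebra.isAssocAction (A : T.Algebra) : IsAssocAction A.a := A.assoc

lemma Algebra.Hom.isActionHom {A B : T.Algebra} (f : A ⟶ B) : IsActionHom A.a B.a f.f := f.h

lemma isAssocAction_μHom (X : M) : IsAssocAction (T.μHom X) := (T.assoc X).symm

@[simp]
lemma Algebra.actionIdem_eq (A : T.Algebra) : actionIdem A.a = 𝟙 A.A := A.unit

lemma actionIdem_μHom (X : M) : actionIdem (T.μHom X) = 𝟙 _ := T.ηHom_comp_μHom X

lemma IsActionHom.id (a : T.obj A ⟶ A) : IsActionHom a a (𝟙 A) := by simp [IsActionHom]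

lemma IsActionHom.comp {f : A ⟶ B} {g : B ⟶ C} (hf : IsActionHom a b f) (hg : IsActionHom b c g) :
    IsActionHom a c (f ≫ g) := by
  unfold IsActionHom at *
  rw [T.map_comp, Category.assoc, hg, reassoc_of% hf]

lemma IsActionHom.of_comp {f : A ⟶ B} {g : B ⟶ C} (hf : IsActionHom a b f)
    (hfg : IsActionHom a c (f ≫ g)) [IsSplitEpi f] : IsActionHom b c g := by
  unfold IsActionHom at *
  rw [← cancel_epi (T.map f), reassoc_of% hf, ← hfg, T.map_comp, Category.assoc]

lemma IsActionHom.actionIdem_comp {f : A ⟶ B} (hf : IsActionHom a b f) :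
    actionIdem a ≫ f = f ≫ actionIdem b := by
  unfold IsActionHom at hf
  rw [actionIdem, actionIdem, Category.assoc, ← hf, reassoc_of% comp_ηHom]

lemma IsAssocAction.isActionHom (ha : IsAssocAction a) : IsActionHom (T.μHom A) a a := ha.symm

/-- By associativity `a` is itself equivariant from the free action, whose idempotent is the
identity. -/
lemma IsAssocAction.comp_actionIdem (ha : IsAssocAction a) : a ≫ actionIdem a = a := by
  rw [← ha.isActionHom.actionIdem_comp, actionIdem, ηHom_comp_μHom, Category.id_comp]

lemma IsAssocAction.map_actionIdem_comp (ha : IsAssocAction a) :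
    T.map (actionIdem a) ≫ a = a := by
  rw [actionIdem, T.map_comp, Category.assoc, ← ha, reassoc_of% map_ηHom_comp_μHom]

lemma IsAssocAction.actionIdem_comp_actionIdem (ha : IsAssocAction a) :
    actionIdem a ≫ actionIdem a = actionIdem a := by
  conv_lhs => lhs; unfold actionIdem
  rw [Category.assoc, ha.comp_actionIdem, actionIdem]

/-- In an idempotent complete category, a possibly non-unital algebra of a monad has a largest
unital retract. -/
lemma IsAssocAction.exists_split [IsIdempotentComplete M] (ha : IsAssocAction a) :
    ∃ (B : T.Algebra) (i : B.A ⟶ A) (p : A ⟶ B.A), i ≫ p = 𝟙 B.A ∧ p ≫ i = actionIdem a ∧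
      IsActionHom B.a a i ∧ IsActionHom a B.a p := by
  obtain ⟨B, i, p, hip, hpi⟩ :=
    IsIdempotentComplete.idempotents_split A (actionIdem a) ha.actionIdem_comp_actionIdem
  have hunit : T.ηHom B ≫ T.map i ≫ a ≫ p = 𝟙 B := by
    have h : T.ηHom A ≫ a ≫ p = p ≫ i ≫ p := by rw [reassoc_of% hpi, actionIdem, Category.assoc]
    rw [← reassoc_of% comp_ηHom, h, hip, Category.comp_id, hip]
  have hassoc : T.μHom B ≫ T.map i ≫ a ≫ p = T.map (T.map i ≫ a ≫ p) ≫ T.map i ≫ a ≫ p := by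
    rw [T.map_comp, T.map_comp, Category.assoc, Category.assoc, ← T.map_comp_assoc p, hpi,
      reassoc_of% ha.map_actionIdem_comp, ← reassoc_of% map_map_comp_μHom]
    unfold IsAssocAction at ha
    rw [reassoc_of% ha]
  have hi : T.map i ≫ a = (T.map i ≫ a ≫ p) ≫ i := by
    rw [Category.assoc, Category.assoc, hpi, ha.comp_actionIdem]
  have hp : T.map p ≫ T.map i ≫ a ≫ p = a ≫ p := by
    rw [← T.map_comp_assoc, hpi, reassoc_of% ha.map_actionIdem_comp]
  exact ⟨⟨B, T.map i ≫ a ≫ p, hunit, hassoc⟩, i, p, hip, hpi, hi, hp⟩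

end CategoryTheory.Monad

/-! ### Tensor products of actions and their idempotents. -/

namespace CompatibleOpmonoidalStructure

open Monad

variable {M : Type u} [Category.{v} M] [MonoidalCategory M] {T : Monad M}
  (S : CompatibleOpmonoidalStructure T)

/-- The binary part of the opmonoidal structure. -/
def τ (X Y : M) : T.obj (X ⊗ Y) ⟶ T.obj X ⊗ T.obj Y := S.δ X Y

/-- The nullary part of the opmonoidal structure. -/
def τ₀ : T.obj (𝟙_ M) ⟶ 𝟙_ M := S.η

lemma τ_natural {X X' Y Y' : M} (f : X ⟶ X') (g : Y ⟶ Y') :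
    S.τ X Y ≫ (T.map f ⊗ₘ T.map g) = T.map (f ⊗ₘ g) ≫ S.τ X' Y' :=
  letI := S.toOplaxMonoidal
  δ_natural T.toFunctor f g

lemma τ_natural_left {X X' : M} (f : X ⟶ X') (Y : M) :
    S.τ X Y ≫ T.map f ▷ T.obj Y = T.map (f ▷ Y) ≫ S.τ X' Y :=
  S.δ_natural_left f Y

lemma τ_natural_right (X : M) {Y Y' : M} (f : Y ⟶ Y') :
    S.τ X Y ≫ T.obj X ◁ T.map f = T.map (X ◁ f) ≫ S.τ X Y' :=
  S.δ_natural_right X f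

lemma τ_associativity (X Y Z : M) :
    S.τ (X ⊗ Y) Z ≫ S.τ X Y ▷ T.obj Z ≫ (α_ (T.obj X) (T.obj Y) (T.obj Z)).hom =
      T.map (α_ X Y Z).hom ≫ S.τ X (Y ⊗ Z) ≫ T.obj X ◁ S.τ Y Z :=
  S.oplax_associativity X Y Z

lemma τ_left_unitality (X : M) :
    S.τ (𝟙_ M) X ≫ S.τ₀ ▷ T.obj X ≫ (λ_ (T.obj X)).hom = T.map (λ_ X).hom :=
  letI := S.toOplaxMonoidal
  left_unitality_hom T.toFunctor X

lemma τ_right_unitality (X : M) :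
    S.τ X (𝟙_ M) ≫ T.obj X ◁ S.τ₀ ≫ (ρ_ (T.obj X)).hom = T.map (ρ_ X).hom :=
  letI := S.toOplaxMonoidal
  right_unitality_hom T.toFunctor X

lemma map_τ_comp_τ (X Y : M) :
    T.map (S.τ X Y) ≫ S.τ (T.obj X) (T.obj Y) ≫ (T.μHom X ⊗ₘ T.μHom Y) =
      T.μHom (X ⊗ Y) ≫ S.τ X Y := S.tau_5 X Y

lemma right_unit_condition (X : M) :
    T.map (T.ηHom (X ⊗ T.obj (𝟙_ M))) ≫ T.map (S.τ X (T.obj (𝟙_ M))) ≫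
        T.map (T.obj X ◁ T.μHom (𝟙_ M)) ≫ T.map (T.obj X ◁ S.τ₀) ≫
          T.map (ρ_ (T.obj X)).hom ≫ T.μHom X =
      S.τ X (T.obj (𝟙_ M)) ≫ T.obj X ◁ T.μHom (𝟙_ M) ≫ T.obj X ◁ S.τ₀ ≫ (ρ_ (T.obj X)).hom :=
  S.tau_1 X

lemma left_unit_condition (X : M) :
    T.map (T.ηHom (T.obj (𝟙_ M) ⊗ X)) ≫ T.map (S.τ (T.obj (𝟙_ M)) X) ≫
        T.map (T.μHom (𝟙_ M) ▷ T.obj X) ≫ T.map (S.τ₀ ▷ T.obj X) ≫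
          T.map (λ_ (T.obj X)).hom ≫ T.μHom X =
      S.τ (T.obj (𝟙_ M)) X ≫ T.μHom (𝟙_ M) ▷ T.obj X ≫ S.τ₀ ▷ T.obj X ≫ (λ_ (T.obj X)).hom :=
  S.tau_2 X

lemma frobenius_left_condition (X Y Z : M) :
    X ◁ T.ηHom (Y ⊗ Z) ≫ X ◁ S.τ Y Z ≫ (α_ X (T.obj Y) (T.obj Z)).inv ≫
        T.ηHom (X ⊗ T.obj Y) ▷ T.obj Z ≫ S.τ X (T.obj Y) ▷ T.obj Z ≫
          (T.obj X ◁ T.μHom Y) ▷ T.obj Z =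
      (α_ X Y Z).inv ≫ T.ηHom ((X ⊗ Y) ⊗ Z) ≫ S.τ (X ⊗ Y) Z ≫ S.τ X Y ▷ T.obj Z :=
  S.tau_3 X Y Z

lemma frobenius_right_condition (X Y Z : M) :
    T.ηHom (X ⊗ Y) ▷ Z ≫ S.τ X Y ▷ Z ≫ (α_ (T.obj X) (T.obj Y) Z).hom ≫
        T.obj X ◁ T.ηHom (T.obj Y ⊗ Z) ≫ T.obj X ◁ S.τ (T.obj Y) Z ≫
          T.obj X ◁ (T.μHom Y ▷ T.obj Z) =
      T.ηHom ((X ⊗ Y) ⊗ Z) ≫ S.τ (X ⊗ Y) Z ≫ S.τ X Y ▷ T.obj Z ≫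
        (α_ (T.obj X) (T.obj Y) (T.obj Z)).hom :=
  S.tau_4 X Y Z

variable {A A' B B' C : M} {a : T.obj A ⟶ A} {a' : T.obj A' ⟶ A'} {b : T.obj B ⟶ B}
  {b' : T.obj B' ⟶ B'} {c : T.obj C ⟶ C}

/-- The action of the monad on a tensor product. -/
def tensorAction (a : T.obj A ⟶ A) (b : T.obj B ⟶ B) : T.obj (A ⊗ B) ⟶ A ⊗ B :=
  S.τ A B ≫ (a ⊗ₘ b)

/-- This is where condition 5 enters. The unit law can fail, because `u` is not required to be
opmonoidal. -/
lemma isAssocAction_tensorAction (ha : IsAssocAction a) (hb : IsAssocAction b) :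
    IsAssocAction (S.tensorAction a b) := by
  unfold IsAssocAction at *
  rw [tensorAction, T.map_comp, Category.assoc, ← reassoc_of% τ_natural, tensorHom_comp_tensorHom,
    ← ha,
    ← hb, ← tensorHom_comp_tensorHom, reassoc_of% map_τ_comp_τ]

lemma isActionHom_tensorHom {f : A ⟶ A'} {g : B ⟶ B'} (hf : IsActionHom a a' f)
    (hg : IsActionHom b b' g) :
    IsActionHom (S.tensorAction a b) (S.tensorAction a' b') (f ⊗ₘ g) := by
  unfold IsActionHom at *
  rw [tensorAction, tensorAction, ← reassoc_of% τ_natural, Category.assoc, tensorHom_comp_tensorHom,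
    tensorHom_comp_tensorHom, hf, hg]

lemma isActionHom_whiskerRight {f : A ⟶ A'} (hf : IsActionHom a a' f) (b : T.obj B ⟶ B) :
    IsActionHom (S.tensorAction a b) (S.tensorAction a' b) (f ▷ B) := by
  rw [← tensorHom_id]
  exact S.isActionHom_tensorHom hf (.id b)

lemma isActionHom_whiskerLeft (a : T.obj A ⟶ A) {g : B ⟶ B'} (hg : IsActionHom b b' g) :
    IsActionHom (S.tensorAction a b) (S.tensorAction a b') (A ◁ g) := by
  rw [← id_tensorHom]
  exact S.isActionHom_tensorHom (.id a) hg

lemma isActionHom_associator_hom (a : T.obj A ⟶ A) (b : T.obj B ⟶ B) (c : T.obj C ⟶ C) :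
    IsActionHom (S.tensorAction (S.tensorAction a b) c) (S.tensorAction a (S.tensorAction b c))
      (α_ A B C).hom := by
  unfold IsActionHom tensorAction
  rw [← whiskerRight_comp_tensorHom, ← whiskerLeft_comp_tensorHom, Category.assoc, Category.assoc,
    associator_naturality, reassoc_of% τ_associativity]

lemma isActionHom_associator_inv (a : T.obj A ⟶ A) (b : T.obj B ⟶ B) (c : T.obj C ⟶ C) :
    IsActionHom (S.tensorAction a (S.tensorAction b c)) (S.tensorAction (S.tensorAction a b) c)
      (α_ A B C).inv := by
  refine (S.isActionHom_associator_hom a b c).of_comp ?_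
  rw [Iso.hom_inv_id]
  exact .id _

lemma actionIdem_comp_whiskerRight (ha : IsAssocAction a) (c : T.obj C ⟶ C) :
    actionIdem (S.tensorAction a c) ≫ actionIdem a ▷ C = actionIdem (S.tensorAction a c) := by
  rw [actionIdem, tensorAction, Category.assoc, Category.assoc, ← tensorHom_id,
    tensorHom_comp_tensorHom, ha.comp_actionIdem, Category.comp_id]

lemma actionIdem_comp_whiskerLeft (a : T.obj A ⟶ A) (hc : IsAssocAction c) :
    actionIdem (S.tensorAction a c) ≫ A ◁ actionIdem c = actionIdem (S.tensorAction a c) := by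
  rw [actionIdem, tensorAction, Category.assoc, Category.assoc, ← id_tensorHom,
    tensorHom_comp_tensorHom, hc.comp_actionIdem, Category.comp_id]

/-- Condition 3 followed by the three actions, in terms of idempotents. -/
lemma frobenius_left_idem (a : T.obj A ⟶ A) (hb : IsAssocAction b) (c : T.obj C ⟶ C) :
    A ◁ actionIdem (S.tensorAction b c) ≫ (α_ _ _ _).inv ≫ actionIdem (S.tensorAction a b) ▷ C =
      (α_ _ _ _).inv ≫ actionIdem (S.tensorAction (S.tensorAction a b) c) := by
  -- Associativity of `b` trades the multiplication in the middle for a second copy of `b`, which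
  -- naturality moves to the front.
  have h : T.ηHom (A ⊗ T.obj B) ≫ S.τ A (T.obj B) ≫ T.obj A ◁ T.μHom B ≫ (a ⊗ₘ b) =
      A ◁ b ≫ actionIdem (S.tensorAction a b) := by
    unfold IsAssocAction at hb
    rw [whiskerLeft_comp_tensorHom, hb, ← whiskerLeft_comp_tensorHom, reassoc_of% τ_natural_right,
      ← reassoc_of% comp_ηHom]
    rfl
  have h' := congr_arg (· ≫ ((a ⊗ₘ b) ⊗ₘ c)) (S.frobenius_left_condition A B C)
  simp only [Category.assoc, whiskerRight_comp_tensorHom] at h'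
  rw [h, ← tensorHom_comp_whiskerRight, ← id_tensorHom _ b, ← associator_inv_naturality_assoc,
    id_tensorHom, ← MonoidalCategory.whiskerLeft_comp_assoc,
    ← MonoidalCategory.whiskerLeft_comp_assoc] at h'
  simpa only [actionIdem, tensorAction, Category.assoc] using h'

lemma frobenius_right_idem (a : T.obj A ⟶ A) (hb : IsAssocAction b) (c : T.obj C ⟶ C) :
    actionIdem (S.tensorAction a b) ▷ C ≫ (α_ _ _ _).hom ≫ A ◁ actionIdem (S.tensorAction b c) =
      actionIdem (S.tensorAction (S.tensorAction a b) c) ≫ (α_ _ _ _).hom := by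
  have h : T.ηHom (T.obj B ⊗ C) ≫ S.τ (T.obj B) C ≫ T.μHom B ▷ T.obj C ≫ (b ⊗ₘ c) =
      b ▷ C ≫ actionIdem (S.tensorAction b c) := by
    unfold IsAssocAction at hb
    rw [whiskerRight_comp_tensorHom, hb, ← whiskerRight_comp_tensorHom, reassoc_of% τ_natural_left,
      ← reassoc_of% comp_ηHom]
    rfl
  have h' := congr_arg (· ≫ (a ⊗ₘ (b ⊗ₘ c))) (S.frobenius_right_condition A B C)
  simp only [Category.assoc, whiskerLeft_comp_tensorHom] at h'
  rw [h, ← tensorHom_comp_whiskerLeft, ← tensorHom_id b, ← associator_naturality_assoc,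
    tensorHom_id, ← comp_whiskerRight_assoc, ← comp_whiskerRight_assoc, ← associator_naturality,
    whiskerRight_comp_tensorHom_assoc] at h'
  simpa only [actionIdem, tensorAction, Category.assoc] using h'

end CompatibleOpmonoidalStructure

/-! ### Actions of `TK` and the construction of the unit algebra. -/

namespace CompatibleOpmonoidalStructure

open Monad

variable {M : Type u} [Category.{v} M] [MonoidalCategory M] {T : Monad M}
  (S : CompatibleOpmonoidalStructure T)

variable {A B C : M} {a : T.obj A ⟶ A} {b : T.obj B ⟶ B} {c : T.obj C ⟶ C}

/-- The right action of the free algebra on the monoidal unit. -/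
def rightAct (a : T.obj A ⟶ A) : A ⊗ T.obj (𝟙_ M) ⟶ A :=
  actionIdem (S.tensorAction a (T.μHom (𝟙_ M))) ≫ A ◁ S.τ₀ ≫ (ρ_ A).hom

/-- The left action of the free algebra on the monoidal unit. -/
def leftAct (a : T.obj A ⟶ A) : T.obj (𝟙_ M) ⊗ A ⟶ A :=
  actionIdem (S.tensorAction (T.μHom (𝟙_ M)) a) ≫ S.τ₀ ▷ A ≫ (λ_ A).hom

lemma tensorAction_rightAct (ha : IsAssocAction a) :
    S.tensorAction a (T.μHom (𝟙_ M)) ≫ S.rightAct a =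
      S.tensorAction a (T.μHom (𝟙_ M)) ≫ A ◁ S.τ₀ ≫ (ρ_ A).hom := by
  rw [rightAct,
    reassoc_of% (S.isAssocAction_tensorAction ha (isAssocAction_μHom _)).comp_actionIdem]

lemma tensorAction_leftAct (ha : IsAssocAction a) :
    S.tensorAction (T.μHom (𝟙_ M)) a ≫ S.leftAct a =
      S.tensorAction (T.μHom (𝟙_ M)) a ≫ S.τ₀ ▷ A ≫ (λ_ A).hom := by
  rw [leftAct, reassoc_of% (S.isAssocAction_tensorAction (isAssocAction_μHom _) ha).comp_actionIdem]

/-- Condition 1 composed with `a`, which carries the statement from the free algebra on `A` to `A`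
itself. -/
lemma isActionHom_rightAct (ha : IsAssocAction a) :
    IsActionHom (S.tensorAction a (T.μHom (𝟙_ M))) a (S.rightAct a) := by
  have h := congr_arg (· ≫ a) (S.right_unit_condition A)
  have ha' : T.μHom A ≫ a = T.map a ≫ a := ha
  unfold IsActionHom
  rw [tensorAction_rightAct S ha, rightAct, actionIdem, tensorAction, tensorHom_def']
  simp only [Category.assoc, ha', ← T.map_comp_assoc] at h
  simp only [Category.assoc]
  rw [← whisker_exchange_assoc, rightUnitor_naturality]
  exact h

lemma isActionHom_leftAct (ha : IsAssocAction a) :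
    IsActionHom (S.tensorAction (T.μHom (𝟙_ M)) a) a (S.leftAct a) := by
  have h := congr_arg (· ≫ a) (S.left_unit_condition A)
  have ha' : T.μHom A ≫ a = T.map a ≫ a := ha
  unfold IsActionHom
  rw [tensorAction_leftAct S ha, leftAct, actionIdem, tensorAction, MonoidalCategory.tensorHom_def]
  simp only [Category.assoc, ha', ← T.map_comp_assoc] at h
  simp only [Category.assoc]
  rw [whisker_exchange_assoc, leftUnitor_naturality]
  exact h

lemma rightAct_natural {f : A ⟶ B} (hf : IsActionHom a b f) :
    f ▷ T.obj (𝟙_ M) ≫ S.rightAct b = S.rightAct a ≫ f := by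
  rw [rightAct, ← reassoc_of% (S.isActionHom_whiskerRight hf _).actionIdem_comp, rightAct,
    ← whisker_exchange_assoc, rightUnitor_naturality, Category.assoc, Category.assoc]

lemma leftAct_natural {f : A ⟶ B} (hf : IsActionHom a b f) :
    T.obj (𝟙_ M) ◁ f ≫ S.leftAct b = S.leftAct a ≫ f := by
  rw [leftAct, ← reassoc_of% (S.isActionHom_whiskerLeft _ hf).actionIdem_comp, leftAct,
    whisker_exchange_assoc, leftUnitor_naturality, Category.assoc, Category.assoc]

lemma whiskerLeft_ηHom_rightAct (hu : actionIdem a = 𝟙 A) :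
    A ◁ T.ηHom (𝟙_ M) ≫ S.rightAct a = (ρ_ A).hom := by
  rw [rightAct, actionIdem, tensorAction, Category.assoc, reassoc_of% comp_ηHom, Category.assoc,
    ← reassoc_of% τ_natural_right, whiskerLeft_comp_tensorHom_assoc, map_ηHom_comp_μHom,
    tensorHom_id,
    ← whisker_exchange_assoc, rightUnitor_naturality, reassoc_of% τ_right_unitality,
    ← reassoc_of% comp_ηHom]
  change _ ≫ actionIdem a = _
  rw [hu, Category.comp_id]

lemma whiskerRight_ηHom_leftAct (hu : actionIdem a = 𝟙 A) :
    T.ηHom (𝟙_ M) ▷ A ≫ S.leftAct a = (λ_ A).hom := by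
  rw [leftAct, actionIdem, tensorAction, Category.assoc, reassoc_of% comp_ηHom, Category.assoc,
    ← reassoc_of% τ_natural_left, whiskerRight_comp_tensorHom_assoc, map_ηHom_comp_μHom,
    id_tensorHom,
    whisker_exchange_assoc, leftUnitor_naturality, reassoc_of% τ_left_unitality,
    ← reassoc_of% comp_ηHom]
  change _ ≫ actionIdem a = _
  rw [hu, Category.comp_id]

/-- The idempotent on the tensor product of two algebras is balanced. -/
lemma rightAct_actionIdem (ha : IsAssocAction a) (hc : IsAssocAction c) :
    S.rightAct a ▷ C ≫ actionIdem (S.tensorAction a c) =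
      (α_ _ _ _).hom ≫ A ◁ S.leftAct c ≫ actionIdem (S.tensorAction a c) := by
  have hk := isAssocAction_μHom (T := T) (𝟙_ M)
  -- Equivariance of the `TK`-actions reduces both sides to the idempotent of the triple product
  -- `A`, `TK`, `C`, followed by `τ₀` on the middle factor; the associator matches them by the
  -- triangle identity.
  have h₁ : S.rightAct a ▷ C ≫ actionIdem (S.tensorAction a c) =
      actionIdem (S.tensorAction (S.tensorAction a (T.μHom (𝟙_ M))) c) ≫
        (A ◁ S.τ₀ ≫ (ρ_ A).hom) ▷ C := by
    rw [← (S.isActionHom_whiskerRight (S.isActionHom_rightAct ha) c).actionIdem_comp, rightAct,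
      comp_whiskerRight,
      reassoc_of% S.actionIdem_comp_whiskerRight (S.isAssocAction_tensorAction ha hk)]
  have h₂ : A ◁ S.leftAct c ≫ actionIdem (S.tensorAction a c) =
      actionIdem (S.tensorAction a (S.tensorAction (T.μHom (𝟙_ M)) c)) ≫
        A ◁ (S.τ₀ ▷ C ≫ (λ_ C).hom) := by
    rw [← (S.isActionHom_whiskerLeft a (S.isActionHom_leftAct hc)).actionIdem_comp, leftAct,
      MonoidalCategory.whiskerLeft_comp, reassoc_of% S.actionIdem_comp_whiskerLeft _
        (S.isAssocAction_tensorAction hk hc)]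
  rw [h₁, h₂, ← reassoc_of% (S.isActionHom_associator_hom _ _ _).actionIdem_comp]
  simp

/-- Balancedness with `C = TK`, followed by `τ₀`: the right action is associative for the product on
`TK` given by its left action on itself. `leftAct_leftAct` involves the right action instead. -/
lemma rightAct_rightAct (ha : IsAssocAction a) :
    S.rightAct a ▷ T.obj (𝟙_ M) ≫ S.rightAct a =
      (α_ _ _ _).hom ≫ A ◁ S.leftAct (T.μHom (𝟙_ M)) ≫ S.rightAct a :=
  (reassoc_of% S.rightAct_actionIdem ha (isAssocAction_μHom (𝟙_ M))) _

lemma leftAct_leftAct (ha : IsAssocAction a) :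
    S.rightAct (T.μHom (𝟙_ M)) ▷ A ≫ S.leftAct a =
      (α_ _ _ _).hom ≫ T.obj (𝟙_ M) ◁ S.leftAct a ≫ S.leftAct a :=
  (reassoc_of% S.rightAct_actionIdem (isAssocAction_μHom (𝟙_ M)) ha) _

/-- The idempotent on the free algebra on the unit, given by acting on the unit on the right. -/
def unitIdem : T.obj (𝟙_ M) ⟶ T.obj (𝟙_ M) :=
  (λ_ _).inv ≫ T.ηHom (𝟙_ M) ▷ _ ≫ S.rightAct (T.μHom (𝟙_ M))

/-- The idempotent on the free algebra on the unit, given by acting on the unit on the left. -/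
def unitIdem' : T.obj (𝟙_ M) ⟶ T.obj (𝟙_ M) :=
  (ρ_ _).inv ≫ _ ◁ T.ηHom (𝟙_ M) ≫ S.leftAct (T.μHom (𝟙_ M))

/-- In element notation, with `u` the unit in `TK`: `a·(x·u) = (a·x)·u = a·x`. -/
lemma whiskerLeft_unitIdem'_rightAct (ha : IsAssocAction a) (hu : actionIdem a = 𝟙 A) :
    A ◁ S.unitIdem' ≫ S.rightAct a = S.rightAct a := by
  have h : A ◁ S.leftAct (T.μHom (𝟙_ M)) ≫ S.rightAct a =
      (α_ _ _ _).inv ≫ S.rightAct a ▷ T.obj (𝟙_ M) ≫ S.rightAct a := by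
    rw [S.rightAct_rightAct ha, Iso.inv_hom_id_assoc]
  rw [unitIdem', MonoidalCategory.whiskerLeft_comp, MonoidalCategory.whiskerLeft_comp,
    Category.assoc, Category.assoc, h, associator_inv_naturality_right_assoc,
    whisker_exchange_assoc, whiskerLeft_ηHom_rightAct S hu, rightUnitor_naturality]
  simp

lemma unitIdem_whiskerRight_leftAct (ha : IsAssocAction a) (hu : actionIdem a = 𝟙 A) :
    S.unitIdem ▷ A ≫ S.leftAct a = S.leftAct a := by
  rw [unitIdem, comp_whiskerRight, comp_whiskerRight, Category.assoc, Category.assoc,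
    S.leftAct_leftAct ha, associator_naturality_left_assoc, ← whisker_exchange_assoc,
    whiskerRight_ηHom_leftAct S hu, leftUnitor_naturality]
  simp

lemma unitIdem'_unitIdem : S.unitIdem' ≫ S.unitIdem = S.unitIdem := by
  rw [unitIdem, leftUnitor_inv_naturality_assoc, whisker_exchange_assoc,
    S.whiskerLeft_unitIdem'_rightAct (isAssocAction_μHom _) (actionIdem_μHom _)]

lemma unitIdem_unitIdem' : S.unitIdem ≫ S.unitIdem' = S.unitIdem' := by
  rw [unitIdem', rightUnitor_inv_naturality_assoc, ← whisker_exchange_assoc,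
    S.unitIdem_whiskerRight_leftAct (isAssocAction_μHom _) (actionIdem_μHom _)]

/-- Each of `unitIdem` and `unitIdem'` is unchanged by precomposition with the other. Hence both are
idempotent and define the same quotient of `TK`. -/
lemma unitIdem_unitIdem : S.unitIdem ≫ S.unitIdem = S.unitIdem := by
  conv_lhs => rhs; rw [← unitIdem'_unitIdem]
  rw [reassoc_of% unitIdem_unitIdem', unitIdem'_unitIdem]

lemma whiskerLeft_unitIdem_rightAct (ha : IsAssocAction a) (hu : actionIdem a = 𝟙 A) :
    A ◁ S.unitIdem ≫ S.rightAct a = S.rightAct a := by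
  conv_lhs => rw [← S.whiskerLeft_unitIdem'_rightAct ha hu]
  rw [← MonoidalCategory.whiskerLeft_comp_assoc, unitIdem_unitIdem',
    whiskerLeft_unitIdem'_rightAct S ha hu]

/-- The point is that `g` enters the right-hand side only through `T.map g ≫ T.μHom (𝟙_ M) ≫ S.τ₀`.
-/
lemma comp_unitIdem {Y : M} (g : Y ⟶ T.obj (𝟙_ M)) :
    g ≫ S.unitIdem = (λ_ _).inv ≫ T.ηHom (𝟙_ M ⊗ Y) ≫ S.τ (𝟙_ M) Y ≫
      T.obj (𝟙_ M) ◁ (T.map g ≫ T.μHom (𝟙_ M) ≫ S.τ₀) ≫ (ρ_ _).hom := by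
  rw [unitIdem, leftUnitor_inv_naturality_assoc, whisker_exchange_assoc, rightAct, actionIdem,
    tensorAction, Category.assoc, reassoc_of% comp_ηHom, reassoc_of% comp_ηHom, Category.assoc,
    ← reassoc_of% τ_natural_right, ← reassoc_of% τ_natural_left, whiskerLeft_comp_tensorHom_assoc,
    whiskerRight_comp_tensorHom_assoc, map_ηHom_comp_μHom, id_tensorHom]
  simp only [MonoidalCategory.whiskerLeft_comp, Category.assoc]

lemma τ_comp_τ₀ :
    S.τ (𝟙_ M) (T.obj (𝟙_ M)) ≫ T.obj (𝟙_ M) ◁ (T.μHom (𝟙_ M) ≫ S.τ₀) ≫ (ρ_ _).hom ≫ S.τ₀ =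
      T.map (λ_ _).hom ≫ T.μHom (𝟙_ M) ≫ S.τ₀ := by
  rw [← rightUnitor_naturality, whisker_exchange_assoc, ← unitors_equal, leftUnitor_naturality,
    reassoc_of% τ_left_unitality]

lemma unitIdem_τ₀ : S.unitIdem ≫ S.τ₀ = S.τ₀ := by
  have h := S.comp_unitIdem (𝟙 _)
  rw [Category.id_comp, T.map_id, Category.id_comp] at h
  rw [h, Category.assoc, Category.assoc, Category.assoc, Category.assoc, τ_comp_τ₀,
    ← reassoc_of% comp_ηHom, reassoc_of% ηHom_comp_μHom, Iso.inv_hom_id_assoc]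

lemma map_unitIdem_μHom_τ₀ : T.map S.unitIdem ≫ T.μHom (𝟙_ M) ≫ S.τ₀ = T.μHom (𝟙_ M) ≫ S.τ₀ := by
  have h : T.map (S.rightAct (T.μHom (𝟙_ M))) ≫ T.μHom (𝟙_ M) = _ :=
    S.isActionHom_rightAct (isAssocAction_μHom _)
  rw [unitIdem, T.map_comp, T.map_comp, Category.assoc, Category.assoc, reassoc_of% h,
    reassoc_of% tensorAction_rightAct S (isAssocAction_μHom _), tensorAction, Category.assoc,
    ← reassoc_of% τ_natural_left, whiskerRight_comp_tensorHom_assoc,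
    map_ηHom_comp_μHom, id_tensorHom, ← MonoidalCategory.whiskerLeft_comp_assoc, τ_comp_τ₀,
    ← T.map_comp_assoc, Iso.inv_hom_id, T.map_id, Category.id_comp]

/-- By `comp_unitIdem` this reduces to the same invariance with `τ₀` in place of the final
`unitIdem`. It is weaker than equivariance of `unitIdem`, yet enough for the quotient of `TK` to
inherit an action. -/
lemma map_unitIdem_μHom_unitIdem :
    T.map S.unitIdem ≫ T.μHom (𝟙_ M) ≫ S.unitIdem = T.μHom (𝟙_ M) ≫ S.unitIdem := by
  rw [← Category.assoc, comp_unitIdem, comp_unitIdem, T.map_comp, Category.assoc,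
    reassoc_of% map_μHom_comp_μHom, reassoc_of% map_map_comp_μHom, map_unitIdem_μHom_τ₀]

lemma exists_unitAlgebra [IsIdempotentComplete M] :
    ∃ (R : T.Algebra) (i : R.A ⟶ T.obj (𝟙_ M)) (p : T.obj (𝟙_ M) ⟶ R.A), i ≫ p = 𝟙 R.A ∧
      p ≫ i = S.unitIdem ∧ R.a = T.map i ≫ T.μHom (𝟙_ M) ≫ p ∧
      IsActionHom (T.μHom (𝟙_ M)) R.a p := by
  obtain ⟨R, i, p, hip, hpi⟩ :=
    IsIdempotentComplete.idempotents_split _ S.unitIdem S.unitIdem_unitIdem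
  have hp : S.unitIdem ≫ p = p := by rw [← hpi, Category.assoc, hip, Category.comp_id]
  have hhom : T.map p ≫ T.map i ≫ T.μHom (𝟙_ M) ≫ p = T.μHom (𝟙_ M) ≫ p := by
    rw [← T.map_comp_assoc, hpi, ← hp, reassoc_of% S.map_unitIdem_μHom_unitIdem]
  have hunit : T.ηHom R ≫ T.map i ≫ T.μHom (𝟙_ M) ≫ p = 𝟙 R := by
    rw [← reassoc_of% comp_ηHom, reassoc_of% ηHom_comp_μHom, hip]
  have hassoc : T.μHom R ≫ T.map i ≫ T.μHom (𝟙_ M) ≫ p =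
      T.map (T.map i ≫ T.μHom (𝟙_ M) ≫ p) ≫ T.map i ≫ T.μHom (𝟙_ M) ≫ p := by
    rw [T.map_comp, T.map_comp, Category.assoc, Category.assoc, hhom,
      reassoc_of% map_μHom_comp_μHom,
      reassoc_of% map_map_comp_μHom]
  exact ⟨⟨R, _, hunit, hassoc⟩, i, p, hip, hpi, rfl, hhom⟩

end CompatibleOpmonoidalStructure

/-! ### The tensor product of algebras and its coherence isomorphisms. -/

namespace CompatibleOpmonoidalStructure

open Monad

variable {M : Type u} [Category.{v} M] [MonoidalCategory M] [IsIdempotentComplete M] {T : Monad M}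
  (S : CompatibleOpmonoidalStructure T)

/-- The tensor product of two algebras. -/
noncomputable def tensorAlg (A B : T.Algebra) : T.Algebra :=
  (S.isAssocAction_tensorAction A.isAssocAction B.isAssocAction).exists_split.choose

/-- The inclusion of the tensor product of two algebras into the tensor product of their
underlying objects. -/
noncomputable def incl (A B : T.Algebra) : (S.tensorAlg A B).A ⟶ A.A ⊗ B.A :=
  (S.isAssocAction_tensorAction A.isAssocAction B.isAssocAction).exists_split.choose_spec.choose

/-- The projection from the tensor product of the underlying objects of two algebras to their
tensor product. -/
noncomputable def proj (A B : T.Algebra) : A.A ⊗ B.A ⟶ (S.tensorAlg A B).A :=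
  (S.isAssocAction_tensorAction
    A.isAssocAction B.isAssocAction).exists_split.choose_spec.choose_spec.choose

lemma tensorAlg_spec (A B : T.Algebra) : S.incl A B ≫ S.proj A B = 𝟙 _ ∧
    S.proj A B ≫ S.incl A B = actionIdem (S.tensorAction A.a B.a) ∧
    IsActionHom (S.tensorAlg A B).a (S.tensorAction A.a B.a) (S.incl A B) ∧
    IsActionHom (S.tensorAction A.a B.a) (S.tensorAlg A B).a (S.proj A B) :=
  (S.isAssocAction_tensorAction
    A.isAssocAction B.isAssocAction).exists_split.choose_spec.choose_spec.choose_spec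

@[simp]
lemma incl_proj (A B : T.Algebra) : S.incl A B ≫ S.proj A B = 𝟙 _ := (S.tensorAlg_spec A B).1

lemma proj_incl (A B : T.Algebra) :
    S.proj A B ≫ S.incl A B = actionIdem (S.tensorAction A.a B.a) := (S.tensorAlg_spec A B).2.1

lemma isActionHom_incl (A B : T.Algebra) :
    IsActionHom (S.tensorAlg A B).a (S.tensorAction A.a B.a) (S.incl A B) :=
  (S.tensorAlg_spec A B).2.2.1

lemma isActionHom_proj (A B : T.Algebra) :
    IsActionHom (S.tensorAction A.a B.a) (S.tensorAlg A B).a (S.proj A B) :=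
  (S.tensorAlg_spec A B).2.2.2

instance (A B : T.Algebra) : IsSplitEpi (S.proj A B) := ⟨⟨S.incl A B, S.incl_proj A B⟩⟩

@[simp]
lemma actionIdem_proj (A B : T.Algebra) :
    actionIdem (S.tensorAction A.a B.a) ≫ S.proj A B = S.proj A B := by
  rw [← proj_incl, Category.assoc, incl_proj, Category.comp_id]

@[simp]
lemma incl_actionIdem (A B : T.Algebra) :
    S.incl A B ≫ actionIdem (S.tensorAction A.a B.a) = S.incl A B := by
  rw [← proj_incl, reassoc_of% incl_proj]

/-- The tensor product of two algebra morphisms. -/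
noncomputable def tensorAlgHom {A A' B B' : T.Algebra} (f : A ⟶ A') (g : B ⟶ B') :
    S.tensorAlg A B ⟶ S.tensorAlg A' B' where
  f := S.incl A B ≫ (f.f ⊗ₘ g.f) ≫ S.proj A' B'
  h := (S.isActionHom_incl A B).comp
    ((S.isActionHom_tensorHom f.isActionHom g.isActionHom).comp (S.isActionHom_proj A' B'))

lemma proj_tensorAlgHom {A A' B B' : T.Algebra} (f : A ⟶ A') (g : B ⟶ B') :
    S.proj A B ≫ (S.tensorAlgHom f g).f = (f.f ⊗ₘ g.f) ≫ S.proj A' B' := by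
  rw [tensorAlgHom, reassoc_of% S.proj_incl,
    reassoc_of% (S.isActionHom_tensorHom f.isActionHom g.isActionHom).actionIdem_comp,
    actionIdem_proj]

lemma tensorAlgHom_incl {A A' B B' : T.Algebra} (f : A ⟶ A') (g : B ⟶ B') :
    (S.tensorAlgHom f g).f ≫ S.incl A' B' = S.incl A B ≫ (f.f ⊗ₘ g.f) := by
  rw [tensorAlgHom, Category.assoc, Category.assoc, S.proj_incl,
    ← (S.isActionHom_tensorHom f.isActionHom g.isActionHom).actionIdem_comp,
    reassoc_of% incl_actionIdem]

lemma proj_whiskerRight_actionIdem (A B C : T.Algebra) :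
    S.proj A B ▷ C.A ≫ actionIdem (S.tensorAction (S.tensorAlg A B).a C.a) =
      actionIdem (S.tensorAction (S.tensorAction A.a B.a) C.a) ≫ S.proj A B ▷ C.A :=
  ((S.isActionHom_whiskerRight (S.isActionHom_proj A B) C.a).actionIdem_comp).symm

lemma proj_whiskerLeft_actionIdem (A B C : T.Algebra) :
    A.A ◁ S.proj B C ≫ actionIdem (S.tensorAction A.a (S.tensorAlg B C).a) =
      actionIdem (S.tensorAction A.a (S.tensorAction B.a C.a)) ≫ A.A ◁ S.proj B C :=
  ((S.isActionHom_whiskerLeft A.a (S.isActionHom_proj B C)).actionIdem_comp).symm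

lemma actionIdem_proj_proj (A B C : T.Algebra) :
    actionIdem (S.tensorAction (S.tensorAction A.a B.a) C.a) ≫ S.proj A B ▷ C.A ≫
      S.proj (S.tensorAlg A B) C = S.proj A B ▷ C.A ≫ S.proj (S.tensorAlg A B) C := by
  rw [← reassoc_of% proj_whiskerRight_actionIdem, actionIdem_proj]

lemma actionIdem_proj_proj' (A B C : T.Algebra) :
    actionIdem (S.tensorAction A.a (S.tensorAction B.a C.a)) ≫ A.A ◁ S.proj B C ≫
      S.proj A (S.tensorAlg B C) = A.A ◁ S.proj B C ≫ S.proj A (S.tensorAlg B C) := by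
  rw [← reassoc_of% proj_whiskerLeft_actionIdem, actionIdem_proj]

/-- The iterated tensor product splits the idempotent of the triple product. The other bracketing
does the same, so the associator of the base category descends. -/
lemma proj_proj_incl_incl (A B C : T.Algebra) :
    S.proj A B ▷ C.A ≫ S.proj (S.tensorAlg A B) C ≫ S.incl (S.tensorAlg A B) C ≫
      S.incl A B ▷ C.A = actionIdem (S.tensorAction (S.tensorAction A.a B.a) C.a) := by
  rw [reassoc_of% S.proj_incl, reassoc_of% proj_whiskerRight_actionIdem, ← comp_whiskerRight,
    S.proj_incl,
    S.actionIdem_comp_whiskerRight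
      (S.isAssocAction_tensorAction A.isAssocAction B.isAssocAction)]

lemma proj_proj_incl_incl' (A B C : T.Algebra) :
    A.A ◁ S.proj B C ≫ S.proj A (S.tensorAlg B C) ≫ S.incl A (S.tensorAlg B C) ≫
      A.A ◁ S.incl B C = actionIdem (S.tensorAction A.a (S.tensorAction B.a C.a)) := by
  rw [reassoc_of% S.proj_incl, reassoc_of% proj_whiskerLeft_actionIdem,
    ← MonoidalCategory.whiskerLeft_comp,
    S.proj_incl, S.actionIdem_comp_whiskerLeft _
      (S.isAssocAction_tensorAction B.isAssocAction C.isAssocAction)]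

/-- The associativity constraint of the tensor product of algebras, on underlying objects. -/
noncomputable def assocHom (A B C : T.Algebra) :
    (S.tensorAlg (S.tensorAlg A B) C).A ⟶ (S.tensorAlg A (S.tensorAlg B C)).A :=
  S.incl (S.tensorAlg A B) C ≫ S.incl A B ▷ C.A ≫ (α_ _ _ _).hom ≫ A.A ◁ S.proj B C ≫
    S.proj A (S.tensorAlg B C)

/-- The inverse of the associativity constraint of the tensor product of algebras, on underlying
objects. -/
noncomputable def assocInv (A B C : T.Algebra) :
    (S.tensorAlg A (S.tensorAlg B C)).A ⟶ (S.tensorAlg (S.tensorAlg A B) C).A :=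
  S.incl A (S.tensorAlg B C) ≫ A.A ◁ S.incl B C ≫ (α_ _ _ _).inv ≫ S.proj A B ▷ C.A ≫
    S.proj (S.tensorAlg A B) C

lemma proj_proj_assocHom (A B C : T.Algebra) :
    S.proj A B ▷ C.A ≫ S.proj (S.tensorAlg A B) C ≫ S.assocHom A B C =
      (α_ _ _ _).hom ≫ A.A ◁ S.proj B C ≫ S.proj A (S.tensorAlg B C) := by
  rw [assocHom, reassoc_of% S.proj_proj_incl_incl,
    reassoc_of% (S.isActionHom_associator_hom _ _ _).actionIdem_comp, actionIdem_proj_proj']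

lemma proj_proj_assocInv (A B C : T.Algebra) :
    A.A ◁ S.proj B C ≫ S.proj A (S.tensorAlg B C) ≫ S.assocInv A B C =
      (α_ _ _ _).inv ≫ S.proj A B ▷ C.A ≫ S.proj (S.tensorAlg A B) C := by
  rw [assocInv, reassoc_of% S.proj_proj_incl_incl',
    reassoc_of% (S.isActionHom_associator_inv _ _ _).actionIdem_comp, actionIdem_proj_proj]

lemma assocHom_incl_incl (A B C : T.Algebra) :
    S.assocHom A B C ≫ S.incl A (S.tensorAlg B C) ≫ A.A ◁ S.incl B C =
      S.incl (S.tensorAlg A B) C ≫ S.incl A B ▷ C.A ≫ (α_ _ _ _).hom := by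
  rw [← cancel_epi (S.proj (S.tensorAlg A B) C), ← cancel_epi (S.proj A B ▷ C.A),
    reassoc_of% S.proj_proj_assocHom, S.proj_proj_incl_incl', reassoc_of% S.proj_proj_incl_incl,
    (S.isActionHom_associator_hom _ _ _).actionIdem_comp]

lemma isActionHom_assocHom (A B C : T.Algebra) :
    IsActionHom (S.tensorAlg (S.tensorAlg A B) C).a (S.tensorAlg A (S.tensorAlg B C)).a
      (S.assocHom A B C) :=
  (S.isActionHom_incl _ _).comp ((S.isActionHom_whiskerRight (S.isActionHom_incl _ _) _).comp
    ((S.isActionHom_associator_hom _ _ _).comp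
      ((S.isActionHom_whiskerLeft _ (S.isActionHom_proj _ _)).comp (S.isActionHom_proj _ _))))

/-- The associativity constraint of the tensor product of algebras. -/
noncomputable def assocIso (A B C : T.Algebra) :
    S.tensorAlg (S.tensorAlg A B) C ≅ S.tensorAlg A (S.tensorAlg B C) :=
  Monad.Algebra.isoMk
    { hom := S.assocHom A B C
      inv := S.assocInv A B C
      hom_inv_id := by
        rw [← cancel_epi (S.proj (S.tensorAlg A B) C), ← cancel_epi (S.proj A B ▷ C.A),
          reassoc_of% S.proj_proj_assocHom, S.proj_proj_assocInv, Iso.hom_inv_id_assoc,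
          Category.comp_id]
      inv_hom_id := by
        rw [← cancel_epi (S.proj A (S.tensorAlg B C)), ← cancel_epi (A.A ◁ S.proj B C),
          reassoc_of% S.proj_proj_assocInv, S.proj_proj_assocHom, Iso.inv_hom_id_assoc,
          Category.comp_id] }
    (S.isActionHom_assocHom A B C)

/-- The monoidal unit of the category of algebras. -/
noncomputable def unitAlg : T.Algebra := S.exists_unitAlgebra.choose

/-- The inclusion of the monoidal unit into the free algebra on the unit. -/
noncomputable def unitIncl : S.unitAlg.A ⟶ T.obj (𝟙_ M) :=
  S.exists_unitAlgebra.choose_spec.choose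

/-- The projection from the free algebra on the unit to the monoidal unit. -/
noncomputable def unitProj : T.obj (𝟙_ M) ⟶ S.unitAlg.A :=
  S.exists_unitAlgebra.choose_spec.choose_spec.choose

lemma unitAlg_spec : S.unitIncl ≫ S.unitProj = 𝟙 _ ∧ S.unitProj ≫ S.unitIncl = S.unitIdem ∧
    S.unitAlg.a = T.map S.unitIncl ≫ T.μHom (𝟙_ M) ≫ S.unitProj ∧
      IsActionHom (T.μHom (𝟙_ M)) S.unitAlg.a S.unitProj :=
  S.exists_unitAlgebra.choose_spec.choose_spec.choose_spec

@[simp]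
lemma unitIncl_unitProj : S.unitIncl ≫ S.unitProj = 𝟙 _ := S.unitAlg_spec.1

lemma unitProj_unitIncl : S.unitProj ≫ S.unitIncl = S.unitIdem := S.unitAlg_spec.2.1

lemma unitAlg_a : S.unitAlg.a = T.map S.unitIncl ≫ T.μHom (𝟙_ M) ≫ S.unitProj :=
  S.unitAlg_spec.2.2.1

lemma isActionHom_unitProj : IsActionHom (T.μHom (𝟙_ M)) S.unitAlg.a S.unitProj :=
  S.unitAlg_spec.2.2.2

instance : IsSplitEpi S.unitProj := ⟨⟨S.unitIncl, S.unitIncl_unitProj⟩⟩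

lemma unitIdem_unitProj : S.unitIdem ≫ S.unitProj = S.unitProj := by
  rw [← unitProj_unitIncl, Category.assoc, unitIncl_unitProj, Category.comp_id]

lemma unitIdem'_unitProj : S.unitIdem' ≫ S.unitProj = S.unitProj := by
  conv_lhs => rw [← unitIdem_unitProj]
  rw [reassoc_of% unitIdem'_unitIdem, unitIdem_unitProj]

/-- The nullary part of the monoidal structure of the forgetful functor. -/
noncomputable def unitIn : 𝟙_ M ⟶ S.unitAlg.A := T.ηHom (𝟙_ M) ≫ S.unitProj

/-- The nullary part of the opmonoidal structure of the forgetful functor. -/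
noncomputable def unitOut : S.unitAlg.A ⟶ 𝟙_ M := S.unitIncl ≫ S.τ₀

lemma unitProj_unitOut : S.unitProj ≫ S.unitOut = S.τ₀ := by
  rw [unitOut, reassoc_of% S.unitProj_unitIncl, unitIdem_τ₀]

/-- The right action of the monoidal unit on an algebra. -/
noncomputable def rightUnitAct (A : T.Algebra) : A.A ⊗ S.unitAlg.A ⟶ A.A :=
  A.A ◁ S.unitIncl ≫ S.rightAct A.a

/-- The left action of the monoidal unit on an algebra. -/
noncomputable def leftUnitAct (A : T.Algebra) : S.unitAlg.A ⊗ A.A ⟶ A.A :=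
  S.unitIncl ▷ A.A ≫ S.leftAct A.a

lemma unitProj_rightUnitAct (A : T.Algebra) :
    A.A ◁ S.unitProj ≫ S.rightUnitAct A = S.rightAct A.a := by
  rw [rightUnitAct, ← MonoidalCategory.whiskerLeft_comp_assoc, unitProj_unitIncl,
    S.whiskerLeft_unitIdem_rightAct A.isAssocAction A.actionIdem_eq]

lemma unitProj_leftUnitAct (A : T.Algebra) :
    S.unitProj ▷ A.A ≫ S.leftUnitAct A = S.leftAct A.a := by
  rw [leftUnitAct, ← comp_whiskerRight_assoc, unitProj_unitIncl,
    S.unitIdem_whiskerRight_leftAct A.isAssocAction A.actionIdem_eq]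

lemma isActionHom_rightUnitAct (A : T.Algebra) :
    IsActionHom (S.tensorAction A.a S.unitAlg.a) A.a (S.rightUnitAct A) := by
  refine (S.isActionHom_whiskerLeft A.a S.isActionHom_unitProj).of_comp ?_
  rw [unitProj_rightUnitAct]
  exact S.isActionHom_rightAct A.isAssocAction

lemma isActionHom_leftUnitAct (A : T.Algebra) :
    IsActionHom (S.tensorAction S.unitAlg.a A.a) A.a (S.leftUnitAct A) := by
  refine (S.isActionHom_whiskerRight S.isActionHom_unitProj A.a).of_comp ?_
  rw [unitProj_leftUnitAct]
  exact S.isActionHom_leftAct A.isAssocAction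

lemma rightUnitAct_natural {A B : T.Algebra} (f : A ⟶ B) :
    f.f ▷ S.unitAlg.A ≫ S.rightUnitAct B = S.rightUnitAct A ≫ f.f := by
  rw [rightUnitAct, ← whisker_exchange_assoc, S.rightAct_natural f.isActionHom, rightUnitAct,
    Category.assoc]

lemma leftUnitAct_natural {A B : T.Algebra} (f : A ⟶ B) :
    S.unitAlg.A ◁ f.f ≫ S.leftUnitAct B = S.leftUnitAct A ≫ f.f := by
  rw [leftUnitAct, whisker_exchange_assoc, S.leftAct_natural f.isActionHom, leftUnitAct,
    Category.assoc]

lemma unitIn_rightUnitAct (A : T.Algebra) :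
    A.A ◁ S.unitIn ≫ S.rightUnitAct A = (ρ_ A.A).hom := by
  rw [unitIn, MonoidalCategory.whiskerLeft_comp, Category.assoc, unitProj_rightUnitAct,
    S.whiskerLeft_ηHom_rightAct A.actionIdem_eq]

lemma unitIn_leftUnitAct (A : T.Algebra) :
    S.unitIn ▷ A.A ≫ S.leftUnitAct A = (λ_ A.A).hom := by
  rw [unitIn, comp_whiskerRight, Category.assoc, unitProj_leftUnitAct,
    S.whiskerRight_ηHom_leftAct A.actionIdem_eq]

/-- Balancedness descends from `TK` to the unit algebra. -/
lemma rightUnitAct_proj (A C : T.Algebra) :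
    S.rightUnitAct A ▷ C.A ≫ S.proj A C =
      (α_ _ _ _).hom ≫ A.A ◁ S.leftUnitAct C ≫ S.proj A C := by
  have h := congr_arg (· ≫ S.proj A C)
    (S.rightAct_actionIdem A.isAssocAction C.isAssocAction)
  simp only [Category.assoc, actionIdem_proj] at h
  rw [rightUnitAct, leftUnitAct, comp_whiskerRight, Category.assoc, h,
    MonoidalCategory.whiskerLeft_comp, Category.assoc, associator_naturality_middle_assoc]

/-- Here the unit is acted upon, not acting. On `TK` this gives `unitIdem'`, which becomes trivial
after `unitProj`. -/
lemma unitIn_leftUnitAct_unitAlg :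
    S.unitAlg.A ◁ S.unitIn ≫ S.leftUnitAct S.unitAlg = (ρ_ _).hom := by
  rw [← cancel_epi (S.unitProj ▷ 𝟙_ M), ← whisker_exchange_assoc, unitProj_leftUnitAct, unitIn,
    MonoidalCategory.whiskerLeft_comp, Category.assoc,
    S.leftAct_natural S.isActionHom_unitProj, rightUnitor_naturality]
  conv_rhs => rw [← S.unitIdem'_unitProj, unitIdem']
  simp only [Category.assoc, Iso.hom_inv_id_assoc]

lemma unitIn_rightUnitAct_unitAlg :
    S.unitIn ▷ S.unitAlg.A ≫ S.rightUnitAct S.unitAlg = (λ_ _).hom := by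
  rw [← cancel_epi (𝟙_ M ◁ S.unitProj), whisker_exchange_assoc, unitProj_rightUnitAct, unitIn,
    comp_whiskerRight, Category.assoc,
    S.rightAct_natural S.isActionHom_unitProj, leftUnitor_naturality]
  conv_rhs => rw [← S.unitIdem_unitProj, unitIdem]
  simp only [Category.assoc, Iso.hom_inv_id_assoc]

lemma proj_incl_rightUnitAct (A : T.Algebra) :
    S.proj A S.unitAlg ≫ S.incl A S.unitAlg ≫ S.rightUnitAct A = S.rightUnitAct A := by
  rw [reassoc_of% S.proj_incl, (S.isActionHom_rightUnitAct A).actionIdem_comp, A.actionIdem_eq,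
    Category.comp_id]

lemma proj_incl_leftUnitAct (A : T.Algebra) :
    S.proj S.unitAlg A ≫ S.incl S.unitAlg A ≫ S.leftUnitAct A = S.leftUnitAct A := by
  rw [reassoc_of% S.proj_incl, (S.isActionHom_leftUnitAct A).actionIdem_comp, A.actionIdem_eq,
    Category.comp_id]

/-- The action of the unit algebra comes from `rightAct`, an idempotent followed by `τ₀`; the
inclusion absorbs that idempotent. Right counitality of the forgetful functor follows. -/
lemma incl_unitOut_right (A : T.Algebra) :
    S.incl A S.unitAlg ≫ A.A ◁ S.unitOut ≫ (ρ_ _).hom =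
      S.incl A S.unitAlg ≫ S.rightUnitAct A := by
  rw [← cancel_epi (S.proj A S.unitAlg), proj_incl_rightUnitAct,
    ← cancel_epi (A.A ◁ S.unitProj), unitProj_rightUnitAct, reassoc_of% S.proj_incl,
    ← reassoc_of% (S.isActionHom_whiskerLeft A.a S.isActionHom_unitProj).actionIdem_comp,
    ← MonoidalCategory.whiskerLeft_comp_assoc, unitProj_unitOut, rightAct]

lemma incl_unitOut_left (A : T.Algebra) :
    S.incl S.unitAlg A ≫ S.unitOut ▷ A.A ≫ (λ_ _).hom =
      S.incl S.unitAlg A ≫ S.leftUnitAct A := by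
  rw [← cancel_epi (S.proj S.unitAlg A), proj_incl_leftUnitAct,
    ← cancel_epi (S.unitProj ▷ A.A), unitProj_leftUnitAct, reassoc_of% S.proj_incl,
    ← reassoc_of% (S.isActionHom_whiskerRight S.isActionHom_unitProj A.a).actionIdem_comp,
    ← comp_whiskerRight_assoc, unitProj_unitOut, leftAct]

/-- The right unit constraint of the tensor product of algebras. -/
noncomputable def rightIso (A : T.Algebra) : S.tensorAlg A S.unitAlg ≅ A :=
  Monad.Algebra.isoMk
    { hom := S.incl A S.unitAlg ≫ S.rightUnitAct A
      inv := (ρ_ _).inv ≫ A.A ◁ S.unitIn ≫ S.proj A S.unitAlg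
      hom_inv_id := by
        -- In element notation: `(a·r) ⊗ 1 = a ⊗ (r·1) = a ⊗ r` by balancedness.
        rw [← cancel_epi (S.proj A S.unitAlg), Category.assoc, reassoc_of% proj_incl_rightUnitAct,
          rightUnitor_inv_naturality_assoc, ← whisker_exchange_assoc, rightUnitAct_proj,
          associator_naturality_right_assoc, ← MonoidalCategory.whiskerLeft_comp_assoc,
          unitIn_leftUnitAct_unitAlg]
        simp
      inv_hom_id := by
        rw [Category.assoc, Category.assoc, proj_incl_rightUnitAct, unitIn_rightUnitAct,
          Iso.inv_hom_id] }
    ((S.isActionHom_incl _ _).comp (S.isActionHom_rightUnitAct A))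

/-- The left unit constraint of the tensor product of algebras. -/
noncomputable def leftIso (A : T.Algebra) : S.tensorAlg S.unitAlg A ≅ A :=
  Monad.Algebra.isoMk
    { hom := S.incl S.unitAlg A ≫ S.leftUnitAct A
      inv := (λ_ _).inv ≫ S.unitIn ▷ A.A ≫ S.proj S.unitAlg A
      hom_inv_id := by
        have h : S.unitAlg.A ◁ S.leftUnitAct A ≫ S.proj S.unitAlg A =
            (α_ _ _ _).inv ≫ S.rightUnitAct S.unitAlg ▷ A.A ≫ S.proj S.unitAlg A := by
          rw [rightUnitAct_proj, Iso.inv_hom_id_assoc]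
        rw [← cancel_epi (S.proj S.unitAlg A), Category.assoc, reassoc_of% proj_incl_leftUnitAct,
          leftUnitor_inv_naturality_assoc, whisker_exchange_assoc, h,
          associator_inv_naturality_left_assoc, ← comp_whiskerRight_assoc,
          unitIn_rightUnitAct_unitAlg]
        simp
      inv_hom_id := by
        rw [Category.assoc, Category.assoc, proj_incl_leftUnitAct, unitIn_leftUnitAct,
          Iso.inv_hom_id] }
    ((S.isActionHom_incl _ _).comp (S.isActionHom_leftUnitAct A))

lemma proj_rightIso (A : T.Algebra) :
    S.proj A S.unitAlg ≫ (S.rightIso A).hom.f = S.rightUnitAct A := S.proj_incl_rightUnitAct A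

lemma proj_leftIso (A : T.Algebra) :
    S.proj S.unitAlg A ≫ (S.leftIso A).hom.f = S.leftUnitAct A := S.proj_incl_leftUnitAct A

end CompatibleOpmonoidalStructure

/-! ### The monoidal category of algebras and its forgetful functor. -/

namespace CompatibleOpmonoidalStructure

open Monad

variable {M : Type u} [Category.{v} M] [MonoidalCategory M] [IsIdempotentComplete M] {T : Monad M}
  (S : CompatibleOpmonoidalStructure T)

lemma tensorAlgHom_id (A B : T.Algebra) : S.tensorAlgHom (𝟙 A) (𝟙 B) = 𝟙 (S.tensorAlg A B) := by
  ext
  rw [← cancel_epi (S.proj A B), proj_tensorAlgHom]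
  simp

lemma tensorAlgHom_comp {A A' A'' B B' B'' : T.Algebra} (f : A ⟶ A') (f' : A' ⟶ A'') (g : B ⟶ B')
    (g' : B' ⟶ B'') :
    S.tensorAlgHom f g ≫ S.tensorAlgHom f' g' = S.tensorAlgHom (f ≫ f') (g ≫ g') := by
  ext
  rw [← cancel_epi (S.proj A B), proj_tensorAlgHom, Algebra.comp_f, reassoc_of% proj_tensorAlgHom,
    proj_tensorAlgHom, tensorHom_comp_tensorHom_assoc, Algebra.comp_f, Algebra.comp_f]

lemma assocIso_hom_f (A B C : T.Algebra) : (S.assocIso A B C).hom.f = S.assocHom A B C := rfl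

lemma assocIso_naturality {A A' B B' C C' : T.Algebra} (f : A ⟶ A') (g : B ⟶ B') (h : C ⟶ C') :
    S.tensorAlgHom (S.tensorAlgHom f g) h ≫ (S.assocIso A' B' C').hom =
      (S.assocIso A B C).hom ≫ S.tensorAlgHom f (S.tensorAlgHom g h) := by
  ext
  rw [Algebra.comp_f, Algebra.comp_f, assocIso_hom_f, assocIso_hom_f,
    ← cancel_epi (S.proj (S.tensorAlg A B) C), ← cancel_epi (S.proj A B ▷ C.A),
    reassoc_of% proj_proj_assocHom, proj_tensorAlgHom, reassoc_of% proj_tensorAlgHom,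
    whiskerRight_comp_tensorHom_assoc, proj_tensorAlgHom, ← tensorHom_comp_whiskerRight_assoc,
    proj_proj_assocHom, associator_naturality_assoc, whiskerLeft_comp_tensorHom_assoc,
    proj_tensorAlgHom, tensorHom_comp_whiskerLeft_assoc]

/-- After precomposition with the three projections onto the iterated tensor product, every
constraint becomes an associator of the base category, and its pentagon applies. -/
lemma assocIso_pentagon (A B C D : T.Algebra) :
    S.tensorAlgHom (S.assocIso A B C).hom (𝟙 D) ≫ (S.assocIso A (S.tensorAlg B C) D).hom ≫
        S.tensorAlgHom (𝟙 A) (S.assocIso B C D).hom =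
      (S.assocIso (S.tensorAlg A B) C D).hom ≫ (S.assocIso A B (S.tensorAlg C D)).hom := by
  ext
  simp only [Algebra.comp_f, assocIso_hom_f]
  rw [← cancel_epi (S.proj (S.tensorAlg (S.tensorAlg A B) C) D),
    ← cancel_epi (S.proj (S.tensorAlg A B) C ▷ D.A), ← cancel_epi (S.proj A B ▷ C.A ▷ D.A),
    reassoc_of% proj_tensorAlgHom, reassoc_of% proj_proj_assocHom, assocIso_hom_f, Algebra.id_f,
    tensorHom_id,
    ← comp_whiskerRight_assoc, ← comp_whiskerRight_assoc, Category.assoc, proj_proj_assocHom,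
    comp_whiskerRight_assoc, comp_whiskerRight_assoc, reassoc_of% proj_proj_assocHom,
    associator_naturality_middle_assoc, proj_tensorAlgHom, assocIso_hom_f, Algebra.id_f,
    id_tensorHom, ← MonoidalCategory.whiskerLeft_comp_assoc,
    ← MonoidalCategory.whiskerLeft_comp_assoc, Category.assoc, proj_proj_assocHom,
    associator_naturality_left_assoc, ← whisker_exchange_assoc, proj_proj_assocHom,
    associator_naturality_right_assoc]
  simp only [MonoidalCategory.whiskerLeft_comp, Category.assoc]
  rw [pentagon_assoc]

lemma rightIso_naturality {A B : T.Algebra} (f : A ⟶ B) :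
    S.tensorAlgHom f (𝟙 S.unitAlg) ≫ (S.rightIso B).hom = (S.rightIso A).hom ≫ f := by
  ext
  rw [Algebra.comp_f, Algebra.comp_f, ← cancel_epi (S.proj A S.unitAlg),
    reassoc_of% proj_tensorAlgHom,
    proj_rightIso, reassoc_of% S.proj_rightIso, Algebra.id_f, tensorHom_id, rightUnitAct_natural]

lemma leftIso_naturality {A B : T.Algebra} (f : A ⟶ B) :
    S.tensorAlgHom (𝟙 S.unitAlg) f ≫ (S.leftIso B).hom = (S.leftIso A).hom ≫ f := by
  ext
  rw [Algebra.comp_f, Algebra.comp_f, ← cancel_epi (S.proj S.unitAlg A),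
    reassoc_of% proj_tensorAlgHom,
    proj_leftIso, reassoc_of% S.proj_leftIso, Algebra.id_f, id_tensorHom, leftUnitAct_natural]

lemma assocIso_triangle (A B : T.Algebra) :
    (S.assocIso A S.unitAlg B).hom ≫ S.tensorAlgHom (𝟙 A) (S.leftIso B).hom =
      S.tensorAlgHom (S.rightIso A).hom (𝟙 B) := by
  ext
  rw [Algebra.comp_f, assocIso_hom_f, ← cancel_epi (S.proj (S.tensorAlg A S.unitAlg) B),
    ← cancel_epi (S.proj A S.unitAlg ▷ B.A), reassoc_of% proj_proj_assocHom, proj_tensorAlgHom,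
    proj_tensorAlgHom, Algebra.id_f, Algebra.id_f, id_tensorHom, tensorHom_id,
    ← comp_whiskerRight_assoc, proj_rightIso, rightUnitAct_proj,
    ← MonoidalCategory.whiskerLeft_comp_assoc, proj_leftIso]

/-- The monoidal structure on the category of algebras defined by a compatible opmonoidal
structure on the monad. -/
@[reducible]
noncomputable def monoidalCategory : MonoidalCategory T.Algebra :=
  letI : MonoidalCategoryStruct T.Algebra :=
    { tensorObj := S.tensorAlg
      whiskerLeft := fun A _ _ f => S.tensorAlgHom (𝟙 A) f
      whiskerRight := fun f B => S.tensorAlgHom f (𝟙 B)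
      tensorHom := S.tensorAlgHom
      tensorUnit := S.unitAlg
      associator := S.assocIso
      leftUnitor := S.leftIso
      rightUnitor := S.rightIso }
  MonoidalCategory.ofTensorHom
    (id_tensorHom_id := S.tensorAlgHom_id)
    (tensorHom_comp_tensorHom := fun f₁ f₂ g₁ g₂ => S.tensorAlgHom_comp f₁ g₁ f₂ g₂)
    (associator_naturality := S.assocIso_naturality)
    (leftUnitor_naturality := S.leftIso_naturality)
    (rightUnitor_naturality := S.rightIso_naturality)
    (pentagon := S.assocIso_pentagon)
    (triangle := S.assocIso_triangle)

/-- The monoidal structure on the forgetful functor defined by a compatible opmonoidal structure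
on the monad. -/
@[reducible]
noncomputable def forgetLaxMonoidal :
    letI := S.monoidalCategory
    T.forget.LaxMonoidal :=
  letI := S.monoidalCategory
  { ε := S.unitIn
    μ := S.proj
    μ_natural_left := fun {A A'} f B => by
      change f.f ▷ B.A ≫ S.proj A' B = S.proj A B ≫ (S.tensorAlgHom f (𝟙 B)).f
      rw [proj_tensorAlgHom, Algebra.id_f, tensorHom_id]
    μ_natural_right := fun {B B'} A f => by
      change A.A ◁ f.f ≫ S.proj A B' = S.proj A B ≫ (S.tensorAlgHom (𝟙 A) f).f
      rw [proj_tensorAlgHom, Algebra.id_f, id_tensorHom]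
    associativity := fun A B C => S.proj_proj_assocHom A B C
    left_unitality := fun A => by
      change (λ_ A.A).hom = S.unitIn ▷ A.A ≫ S.proj S.unitAlg A ≫ (S.leftIso A).hom.f
      rw [proj_leftIso, unitIn_leftUnitAct]
    right_unitality := fun A => by
      change (ρ_ A.A).hom = A.A ◁ S.unitIn ≫ S.proj A S.unitAlg ≫ (S.rightIso A).hom.f
      rw [proj_rightIso, unitIn_rightUnitAct] }

/-- The opmonoidal structure on the forgetful functor defined by a compatible opmonoidal structure
on the monad. -/
@[reducible]
noncomputable def forgetOplaxMonoidal :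
    letI := S.monoidalCategory
    T.forget.OplaxMonoidal :=
  letI := S.monoidalCategory
  { η := S.unitOut
    δ := S.incl
    δ_natural_left := fun {A A'} f B => by
      change S.incl A B ≫ f.f ▷ B.A = (S.tensorAlgHom f (𝟙 B)).f ≫ S.incl A' B
      rw [tensorAlgHom_incl, Algebra.id_f, tensorHom_id]
    δ_natural_right := fun {B B'} A f => by
      change S.incl A B ≫ A.A ◁ f.f = (S.tensorAlgHom (𝟙 A) f).f ≫ S.incl A B'
      rw [tensorAlgHom_incl, Algebra.id_f, id_tensorHom]
    oplax_associativity := fun A B C => (S.assocHom_incl_incl A B C).symm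
    oplax_left_unitality := fun A => by
      change (λ_ A.A).inv = (S.leftIso A).inv.f ≫ S.incl S.unitAlg A ≫ S.unitOut ▷ A.A
      rw [← cancel_mono (λ_ A.A).hom, Category.assoc, Category.assoc, incl_unitOut_left,
        Iso.inv_hom_id]
      exact congr_arg Algebra.Hom.f (S.leftIso A).inv_hom_id.symm
    oplax_right_unitality := fun A => by
      change (ρ_ A.A).inv = (S.rightIso A).inv.f ≫ S.incl A S.unitAlg ≫ A.A ◁ S.unitOut
      rw [← cancel_mono (ρ_ A.A).hom, Category.assoc, Category.assoc, incl_unitOut_right,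
        Iso.inv_hom_id]
      exact congr_arg Algebra.Hom.f (S.rightIso A).inv_hom_id.symm }

lemma forget_frobenius_left (A B C : T.Algebra) :
    A.A ◁ S.incl B C ≫ (α_ A.A B.A C.A).inv ≫ S.proj A B ▷ C.A =
      S.proj A (S.tensorAlg B C) ≫ S.assocInv A B C ≫ S.incl (S.tensorAlg A B) C := by
  -- Inserting this trivial factor makes the idempotent of the triple product appear, so that
  -- `frobenius_left_idem` applies.
  have h : S.incl (S.tensorAlg A B) C = S.incl (S.tensorAlg A B) C ≫ S.incl A B ▷ C.A ≫
      S.proj A B ▷ C.A := by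
    rw [← comp_whiskerRight, incl_proj, id_whiskerRight, Category.comp_id]
  rw [← cancel_epi (A.A ◁ S.proj B C), h, reassoc_of% S.proj_proj_assocInv,
    reassoc_of% S.proj_proj_incl_incl, ← MonoidalCategory.whiskerLeft_comp_assoc, S.proj_incl,
    ← reassoc_of% S.frobenius_left_idem _ B.isAssocAction, ← comp_whiskerRight, actionIdem_proj]

lemma forget_frobenius_right (A B C : T.Algebra) :
    S.incl A B ▷ C.A ≫ (α_ A.A B.A C.A).hom ≫ A.A ◁ S.proj B C =
      S.proj (S.tensorAlg A B) C ≫ S.assocHom A B C ≫ S.incl A (S.tensorAlg B C) := by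
  have h : S.incl A (S.tensorAlg B C) = S.incl A (S.tensorAlg B C) ≫ A.A ◁ S.incl B C ≫
      A.A ◁ S.proj B C := by
    rw [← MonoidalCategory.whiskerLeft_comp, incl_proj, whiskerLeft_id, Category.comp_id]
  rw [← cancel_epi (S.proj A B ▷ C.A), h, reassoc_of% S.proj_proj_assocHom,
    reassoc_of% S.proj_proj_incl_incl', ← comp_whiskerRight_assoc, S.proj_incl,
    ← reassoc_of% (S.isActionHom_associator_hom _ _ _).actionIdem_comp,
    ← reassoc_of% S.frobenius_right_idem _ B.isAssocAction, ← MonoidalCategory.whiskerLeft_comp,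
    actionIdem_proj]

/-- The weak bimonad structure defined by a compatible opmonoidal structure on the monad. -/
noncomputable def toWeakBimonadStructure : WeakBimonadStructure T where
  monoidal := S.monoidalCategory
  frobenius :=
    letI := S.monoidalCategory
    { toLaxMonoidal := S.forgetLaxMonoidal
      toOplaxMonoidal := S.forgetOplaxMonoidal
      frobenius_left := S.forget_frobenius_left
      frobenius_right := S.forget_frobenius_right
      separable := S.incl_proj }

/-! ### Recovering `τ` and `τ₀` from the constructed weak bimonad. -/

lemma map_proj_comp_a_comp_incl (A B : T.Algebra) :
    T.map (S.proj A B) ≫ (S.tensorAlg A B).a ≫ S.incl A B = S.tensorAction A.a B.a := by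
  have h : T.map (S.proj A B) ≫ (S.tensorAlg A B).a = S.tensorAction A.a B.a ≫ S.proj A B :=
    S.isActionHom_proj A B
  rw [reassoc_of% h, S.proj_incl,
    (S.isAssocAction_tensorAction A.isAssocAction B.isAssocAction).comp_actionIdem]

lemma tau_toWeakBimonadStructure (X Y : M) : S.toWeakBimonadStructure.tau X Y = S.τ X Y := by
  -- On free algebras the units, moved past `τ` by naturality, cancel the multiplications.
  have h : T.map (T.ηHom X ⊗ₘ T.ηHom Y) ≫ S.tensorAction (T.μHom X) (T.μHom Y) = S.τ X Y := by
    rw [tensorAction, ← reassoc_of% τ_natural, tensorHom_comp_tensorHom, map_ηHom_comp_μHom,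
      map_ηHom_comp_μHom, id_tensorHom_id, Category.comp_id]
  exact (congr_arg (T.map (T.ηHom X ⊗ₘ T.ηHom Y) ≫ ·)
    (S.map_proj_comp_a_comp_incl (T.free.obj X) (T.free.obj Y))).trans h

lemma tauZero_toWeakBimonadStructure : S.toWeakBimonadStructure.tauZero = S.τ₀ := by
  change T.map S.unitIn ≫ S.unitAlg.a ≫ S.unitOut = _
  rw [unitIn, unitOut, unitAlg_a, T.map_comp, Category.assoc, Category.assoc, Category.assoc,
    ← T.map_comp_assoc S.unitProj, S.unitProj_unitIncl, reassoc_of% S.unitProj_unitIncl,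
    unitIdem_τ₀,
    map_unitIdem_μHom_τ₀, reassoc_of% map_ηHom_comp_μHom]

end CompatibleOpmonoidalStructure

theorem theorem1p2 {M : Type u} [Category.{v} M] [MonoidalCategory M] [IsIdempotentComplete M]
    (T : Monad M) :
    ∃ Φ : WeakBimonadStructure T → CompatibleOpmonoidalStructure T,
      (∀ W : WeakBimonadStructure T, (Φ W).η = W.tauZero ∧ (Φ W).δ = W.tau) ∧
      Function.Surjective Φ ∧
      (∀ W W' : WeakBimonadStructure T, Φ W = Φ W' ↔ Nonempty (W.Iso W')) ∧
      (∀ W W' : WeakBimonadStructure T, Subsingleton (W.Iso W')) := by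
  have hext : ∀ S S' : CompatibleOpmonoidalStructure T, S.η = S'.η → S.δ = S'.δ → S = S' := by
    rintro ⟨⟨⟩⟩ ⟨⟨⟩⟩ rfl rfl
    rfl
  refine ⟨WeakBimonadStructure.toCompatible, fun W => ⟨rfl, rfl⟩, fun S => ?_, fun W W' => ?_,
    fun W W' => inferInstance⟩
  · exact ⟨S.toWeakBimonadStructure, hext _ _ S.tauZero_toWeakBimonadStructure
      (funext₂ S.tau_toWeakBimonadStructure)⟩
  · refine ⟨fun h => ?_, fun ⟨I⟩ => hext _ _ I.tauZero_eq_tauZero (funext₂ I.tau_eq_tau)⟩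
    have h₀ : W.tauZero = W'.tauZero := congr_arg (fun S => S.η) h
    have hδ : W.tau = W'.tau := congr_arg (fun S => S.δ) h
    -- The equalities are reversed because the lax constraints of the identity functor run from the
    -- target structure to the source structure.
    exact ⟨WeakBimonadStructure.isoOfEq h₀.symm hδ.symm⟩
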